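/- Let $\mathcal X,\mathcal Y,\mathcal U,\mathcal V$ be finite sets and let $Q$ be a probability function on $\mathcal X\times\mathcal Y\times\mathcal U\times\mathcal V$. Let $(X_i,Y_i,U_i,V_i)$, $i=1,2,\dots$, be i.i.d. with law $Q$. An $n$-block code consists of finite index sets $\mathcal M_0,\mathcal M_1,\mathcal M_2$, an encoder $e:\mathcal X^n\times\mathcal Y^n\to\mathcal M_0\times\mathcal M_1\times\mathcal M_2$ and decoders $d_x:\mathcal M_0\times\mathcal M_1\times\mathcal U^n\to\mathcal X^n$, $d_y:\mathcal M_0\times\mathcal M_2\times\mathcal V^n\to\mathcal Y^n$. With $(M_0,M_1,M_2)=e(X^n,Y^n)$, $\widehat X^n=d_x(M_0,M_1,U^n)$ and $\widehat Y^n=d_y(M_0,M_2,V^n)$, put $P_e=\max\{\Pr[\widehat X^n\ne X^n],\Pr[\widehat Y^n\ne Y^n]\}$. A triple $(R_0,R_1,R_2)\in\mathbb R^3$ is achievable if for every $\epsilon>0$ and all sufficiently large $n$ there is an $n$-block code with $P_e\le\epsilon$ and $\frac1n\log_2|\mathcal M_i|\le R_i+\epsilon$ for $i=0,1,2$. Let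 $\mathcal R$ be the set of all achievable triples. Let $\mathcal P$ be the family of probability functions $p(w,x,y,u,v)$ on $\mathcal W\times\mathcal X\times\mathcal Y\times\mathcal U\times\mathcal V$, where $\mathcal W$ is a finite set with $|\mathcal W|\le|\mathcal X||\mathcal Y|+3$, such that $\sum_w p(w,x,y,u,v)=Q(x,y,u,v)$ and $p(w,x,y,u,v)=p(w|x,y)\,p(x,y,u,v)$. For $p\in\mathcal P$ let $\mathcal R_{in}^{(p)}$ be the set of all $(R_0,R_1,R_2)\in\mathbb R^3$ with $$R_0\ge\max\{I_p(X,Y;W|U),\,I_p(X,Y;W|V)\},\qquad R_1\ge H_p(X|W,U),\qquad R_2\ge H_p(Y|W,V),$$ where conditional entropy $H_p$ and conditional mutual information $I_p$ are taken in bits, and let $\mathcal R_{in}$ be the closure in $\mathbb R^3$ of $\bigcup_{p\in\mathcal P}\mathcal R_{in}^{(p)}$. Then $\mathcal R_{in}\subseteq\mathcal R$. -/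

import Mathlib

namespace GrayWyner

/-! ### Finite probability and Shannon information (in bits)

A probability function on a finite set `Ω` is a point `p` of the simplex `stdSimplex ℝ Ω`;
a random variable is a function on `Ω`. -/

section Information

variable {Ω A B C : Type*} [Fintype Ω] [Fintype A] [Fintype B] [Fintype C]

/-- Probability of the event `E` under the probability function `p`. -/
noncomputable def prob (p : Ω → ℝ) (E : Set Ω) : ℝ :=
  ∑ ω, E.indicator p ω

/-- The law of the random variable `f`: `law p f a = Prob[f = a]`. -/
noncomputable def law (p : Ω → ℝ) (f : Ω → A) (a : A) : ℝ :=
  prob p {ω | f ω = a}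

/-- Conditional Shannon entropy `H(f | g) = - ∑ p(a, b) log₂ p(a | b)`. Pairs `(a, b)` of
probability zero contribute zero. -/
noncomputable def condEntropy (p : Ω → ℝ) (f : Ω → A) (g : Ω → B) : ℝ :=
  -∑ a, ∑ b, law p (fun ω => (f ω, g ω)) (a, b) *
    Real.logb 2 (law p (fun ω => (f ω, g ω)) (a, b) / law p g b)

/-- Conditional mutual information `I(f ; g | h) = H(f | h) - H(f | g, h)`. -/
noncomputable def condMutualInfo (p : Ω → ℝ) (f : Ω → A) (g : Ω → B) (h : Ω → C) : ℝ :=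
  condEntropy p f h - condEntropy p f (fun ω => (g ω, h ω))

end Information

/-! ### Codes and achievable rates -/

section Coding

variable {X Y U V : Type*}

/-- An `n`-block source code with index sets of sizes `M₀`, `M₁`, `M₂`. -/
structure Code (X Y U V : Type*) (n M₀ M₁ M₂ : ℕ) where
  /-- the encoder at the transmitter -/
  enc : (Fin n → X) × (Fin n → Y) → Fin M₀ × Fin M₁ × Fin M₂
  /-- the decoder at the `x`-receiver -/
  decX : Fin M₀ × Fin M₁ × (Fin n → U) → (Fin n → X)
  /-- the decoder at the `y`-receiver -/
  decY : Fin M₀ × Fin M₂ × (Fin n → V) → (Fin n → Y)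

namespace Code

variable {n M₀ M₁ M₂ : ℕ}

/-- The indices sent for the source block `s = ((xᵢ, yᵢ, uᵢ, vᵢ))ᵢ`; the encoder sees only the
`x` and `y` parts. -/
def msg (c : Code X Y U V n M₀ M₁ M₂) (s : Fin n → X × Y × U × V) :
    Fin M₀ × Fin M₁ × Fin M₂ :=
  c.enc (fun i => (s i).1, fun i => (s i).2.1)

/-- The reconstruction of the `x`-sequence at the `x`-receiver. -/
def hatX (c : Code X Y U V n M₀ M₁ M₂) (s : Fin n → X × Y × U × V) : Fin n → X :=
  c.decX ((c.msg s).1, (c.msg s).2.1, fun i => (s i).2.2.1)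

/-- The reconstruction of the `y`-sequence at the `y`-receiver. -/
def hatY (c : Code X Y U V n M₀ M₁ M₂) (s : Fin n → X × Y × U × V) : Fin n → Y :=
  c.decY ((c.msg s).1, (c.msg s).2.2, fun i => (s i).2.2.2)

variable [Fintype X] [Fintype Y] [Fintype U] [Fintype V]

/-- `P_{e,x}`: the probability that the `x`-sequence is not reproduced, when the source block is
i.i.d. with law `Q`. -/
noncomputable def errX (c : Code X Y U V n M₀ M₁ M₂) (Q : X × Y × U × V → ℝ) : ℝ :=
  prob (fun s : Fin n → X × Y × U × V => ∏ i, Q (s i)) {s | c.hatX s ≠ fun i => (s i).1}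

/-- `P_{e,y}`: the probability that the `y`-sequence is not reproduced, when the source block is
i.i.d. with law `Q`. -/
noncomputable def errY (c : Code X Y U V n M₀ M₁ M₂) (Q : X × Y × U × V → ℝ) : ℝ :=
  prob (fun s : Fin n → X × Y × U × V => ∏ i, Q (s i)) {s | c.hatY s ≠ fun i => (s i).2.1}

/-- `P_e = max {P_{e,x}, P_{e,y}}`. -/
noncomputable def err (c : Code X Y U V n M₀ M₁ M₂) (Q : X × Y × U × V → ℝ) : ℝ :=
  max (c.errX Q) (c.errY Q)

end Code

variable [Fintype X] [Fintype Y] [Fintype U] [Fintype V]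

/-- The rate triple `(R₀, R₁, R₂)` is achievable for the memoryless source `Q`. -/
def Achievable (Q : X × Y × U × V → ℝ) (R : ℝ × ℝ × ℝ) : Prop :=
  ∀ ε : ℝ, 0 < ε → ∀ᶠ n : ℕ in Filter.atTop,
    ∃ (M₀ M₁ M₂ : ℕ) (c : Code X Y U V n M₀ M₁ M₂),
      c.err Q ≤ ε ∧
      1 / (n : ℝ) * Real.logb 2 M₀ ≤ R.1 + ε ∧
      1 / (n : ℝ) * Real.logb 2 M₁ ≤ R.2.1 + ε ∧
      1 / (n : ℝ) * Real.logb 2 M₂ ≤ R.2.2 + ε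

/-- The achievable rate region. -/
def rateRegion (Q : X × Y × U × V → ℝ) : Set (ℝ × ℝ × ℝ) :=
  {R | Achievable Q R}

/-! ### The inner bound -/

/-- `p(w, x, y, u, v)` is a probability function with `(X, Y, U, V)`-marginal `Q` that factors as
`p(w | x, y) p(x, y, u, v)`; here `κ x y w` is the conditional probability `p(w | x, y)`. -/
def Admissible {W : Type*} [Fintype W] (Q : X × Y × U × V → ℝ)
    (p : W × X × Y × U × V → ℝ) : Prop :=
  p ∈ stdSimplex ℝ (W × X × Y × U × V) ∧
  (∀ x y u v, ∑ w, p (w, x, y, u, v) = Q (x, y, u, v)) ∧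
  ∃ κ : X → Y → W → ℝ, (∀ x y, κ x y ∈ stdSimplex ℝ W) ∧
    ∀ w x y u v, p (w, x, y, u, v) = κ x y w * Q (x, y, u, v)

/-- The set of rate triples with `R₀ ≥ max {I(X,Y;W|U), I(X,Y;W|V)}`, `R₁ ≥ H(X|W,U)` and
`R₂ ≥ H(Y|W,V)` under `p`. -/
def innerSet {W : Type*} [Fintype W] (p : W × X × Y × U × V → ℝ) : Set (ℝ × ℝ × ℝ) :=
  let rW : W × X × Y × U × V → W := fun ω => ω.1
  let rX : W × X × Y × U × V → X := fun ω => ω.2.1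
  let rY : W × X × Y × U × V → Y := fun ω => ω.2.2.1
  let rU : W × X × Y × U × V → U := fun ω => ω.2.2.2.1
  let rV : W × X × Y × U × V → V := fun ω => ω.2.2.2.2
  {R | max (condMutualInfo p (fun ω => (rX ω, rY ω)) rW rU)
          (condMutualInfo p (fun ω => (rX ω, rY ω)) rW rV) ≤ R.1 ∧
       condEntropy p rX (fun ω => (rW ω, rU ω)) ≤ R.2.1 ∧
       condEntropy p rY (fun ω => (rW ω, rV ω)) ≤ R.2.2}

/-- The inner bound: the closure of the union of the sets `innerSet p` over all admissible `p`
with a finite alphabet for `W` of cardinality at most `|X| |Y| + 3`. -/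
def innerBound (Q : X × Y × U × V → ℝ) : Set (ℝ × ℝ × ℝ) :=
  closure {R | ∃ k : ℕ, k ≤ Fintype.card X * Fintype.card Y + 3 ∧
    ∃ p : Fin k × X × Y × U × V → ℝ, Admissible Q p ∧ R ∈ innerSet p}

end Coding

end GrayWyner

/-! Random binning takes the place of a covering argument. Pass the source block through the
memoryless test channel `κ` to get a block `w`, and give every possible `w` a uniformly random pair
of bin indices `(f, m)`.

If `f` takes slightly fewer than `2 ^ (n H(W|X,Y))` values, it is nearly uniform even given the
source (`avg_binDeficit_le`), so it can be fixed in advance and never sent. If the pair takes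
slightly more than `2 ^ (n max {H(W|U), H(W|V)})` values, each receiver recovers `w` from the pair
and its side information (`avg_prob_binFail_le`). Hence `m`, the only common message, needs rate
`max {H(W|U), H(W|V)} - H(W|X,Y)`, which is the required maximum of informations because `W` depends
on the source only through `(X, Y)` (`condMutualInfo_channelLaw`). Knowing `w`, the receivers decode
separate bins of `X` and `Y` at rates `H(X|W,U)` and `H(Y|W,V)`.

`exists_deterministic_index` fixes `f` and makes `m` a function of `(x, y)`, so the encoder never
generates `w`. `exists_one_shot_code` assembles these pieces for a single draw of an arbitrary
source; applied to blocks, its error terms are made small by the weak law of large numbers. Finally,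
the rate region is closed. -/

namespace GrayWyner

set_option linter.unusedSectionVars false

/-! ### Moments under product laws -/

section ProductLaw

variable {Ω ι : Type*} [Fintype Ω] [Fintype ι] [DecidableEq ι]

/-- The law of a family, indexed by `ι`, of independent variables with law `p`. -/
noncomputable def iidLaw (p : Ω → ℝ) (s : ι → Ω) : ℝ := ∏ i, p (s i)

theorem sum_pi_prod (g : ι → Ω → ℝ) :
    ∑ s : ι → Ω, ∏ i, g i (s i) = ∏ i, ∑ ω, g i ω := by
  classical
  rw [Finset.prod_univ_sum]
  simp [Fintype.piFinset_univ]

theorem iidLaw_nonneg {p : Ω → ℝ} (hp : ∀ ω, 0 ≤ p ω) (s : ι → Ω) : 0 ≤ iidLaw p s :=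
  Finset.prod_nonneg fun i _ => hp (s i)

theorem sum_iidLaw {p : Ω → ℝ} (h1 : ∑ ω, p ω = 1) : ∑ s : ι → Ω, iidLaw p s = 1 := by
  simp only [iidLaw, sum_pi_prod (fun _ => p), h1, Finset.prod_const_one]

theorem sum_iidLaw_mul {p : Ω → ℝ} (h1 : ∑ ω, p ω = 1) (i : ι) (h : Ω → ℝ) :
    ∑ s : ι → Ω, iidLaw p s * h (s i) = ∑ ω, p ω * h ω := by
  classical
  have key : ∀ s : ι → Ω, iidLaw p s * h (s i) =
      ∏ j, p (s j) * (if j = i then h (s j) else 1) := by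
    intro s
    rw [Finset.prod_mul_distrib, Finset.prod_ite_eq' Finset.univ i (fun j => h (s j))]
    simp [iidLaw]
  simp only [key]
  rw [sum_pi_prod (fun j ω => p ω * (if j = i then h ω else 1)),
    Finset.prod_eq_single i]
  · simp
  · intro j _ hj
    simp [hj, h1]
  · simp

theorem sum_iidLaw_mul_mul {p : Ω → ℝ} (h1 : ∑ ω, p ω = 1) {i j : ι} (hij : i ≠ j)
    (h k : Ω → ℝ) :
    ∑ s : ι → Ω, iidLaw p s * (h (s i) * k (s j)) = (∑ ω, p ω * h ω) * ∑ ω, p ω * k ω := by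
  classical
  have key : ∀ s : ι → Ω, iidLaw p s * (h (s i) * k (s j)) =
      ∏ l, p (s l) * ((if l = i then h (s l) else 1) * (if l = j then k (s l) else 1)) := by
    intro s
    rw [Finset.prod_mul_distrib, Finset.prod_mul_distrib,
      Finset.prod_ite_eq' Finset.univ i (fun j => h (s j)),
      Finset.prod_ite_eq' Finset.univ j (fun j => k (s j))]
    simp [iidLaw]
  simp only [key]
  rw [sum_pi_prod (fun l ω => p ω *
      ((if l = i then h ω else 1) * (if l = j then k ω else 1))),
    Fintype.prod_eq_mul i j hij]
  · simp [hij, hij.symm]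
  · rintro l ⟨hi, hj⟩
    simp [hi, hj, h1]

/-- Cross terms vanish by independence and centring. The summands may vary with the index: for
random binnings the index set is the alphabet being binned. -/
theorem sum_iidLaw_mul_sq {p : Ω → ℝ} (h1 : ∑ ω, p ω = 1) (h : ι → Ω → ℝ)
    (h0 : ∀ i, ∑ ω, p ω * h i ω = 0) :
    ∑ s : ι → Ω, iidLaw p s * (∑ i, h i (s i)) ^ 2 = ∑ i, ∑ ω, p ω * h i ω ^ 2 := by
  classical
  have key : ∀ s : ι → Ω, iidLaw p s * (∑ i, h i (s i)) ^ 2 =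
      ∑ i, ∑ j, iidLaw p s * (h i (s i) * h j (s j)) := by
    intro s
    rw [sq, Finset.sum_mul_sum, Finset.mul_sum]
    exact Finset.sum_congr rfl fun i _ => Finset.mul_sum _ _ _
  simp only [key]
  rw [Finset.sum_comm]
  refine Finset.sum_congr rfl fun i _ => ?_
  rw [Finset.sum_comm, Finset.sum_eq_single i]
  · simp only [← sq]
    exact sum_iidLaw_mul h1 i (fun ω => h i ω ^ 2)
  · intro j _ hj
    rw [sum_iidLaw_mul_mul h1 hj.symm (h i) (h j), h0 i, zero_mul]
  · simp

end ProductLaw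

/-! ### Events, laws and conditional laws -/

section Prob

variable {Ω Ω' A C : Type*} [Fintype Ω] [Fintype Ω'] [Fintype A] [Fintype C]

open scoped Classical in
theorem prob_eq_sum_ite (p : Ω → ℝ) (E : Set Ω) :
    prob p E = ∑ ω, if ω ∈ E then p ω else 0 := by
  simp only [prob, Set.indicator_apply]

theorem prob_nonneg {p : Ω → ℝ} (hp : ∀ ω, 0 ≤ p ω) (E : Set Ω) : 0 ≤ prob p E :=
  Finset.sum_nonneg fun ω _ => Set.indicator_nonneg (fun x _ => hp x) ω

/-- Inclusion is only asked on the support, where the logarithms used later have positive arguments.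
-/
theorem prob_mono {p : Ω → ℝ} (hp : ∀ ω, 0 ≤ p ω) {E F : Set Ω}
    (h : ∀ ω, 0 < p ω → ω ∈ E → ω ∈ F) : prob p E ≤ prob p F := by
  classical
  rw [prob_eq_sum_ite, prob_eq_sum_ite]
  refine Finset.sum_le_sum fun ω _ => ?_
  rcases (hp ω).lt_or_eq with h0 | h0
  · have := h ω h0
    split_ifs <;> first | exact le_rfl | exact hp ω | tauto
  · simp [← h0]

theorem prob_union_le {p : Ω → ℝ} (hp : ∀ ω, 0 ≤ p ω) (E F : Set Ω) :
    prob p (E ∪ F) ≤ prob p E + prob p F := by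
  classical
  simp only [prob_eq_sum_ite, ← Finset.sum_add_distrib]
  refine Finset.sum_le_sum fun ω _ => ?_
  have := hp ω
  by_cases h1 : ω ∈ E <;> by_cases h2 : ω ∈ F <;> simp [h1, h2, this]

theorem prob_equiv (e : Ω' ≃ Ω) (p : Ω → ℝ) (E : Set Ω) :
    prob (fun ω => p (e ω)) {ω | e ω ∈ E} = prob p E := by
  classical
  simp only [prob_eq_sum_ite]
  exact Fintype.sum_equiv e _ _ fun ω => by simp

theorem law_nonneg {p : Ω → ℝ} (hp : ∀ ω, 0 ≤ p ω) (f : Ω → A) (a : A) : 0 ≤ law p f a :=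
  prob_nonneg hp _

open scoped Classical in
theorem law_eq_sum_ite (p : Ω → ℝ) (f : Ω → A) (a : A) :
    law p f a = ∑ ω, if f ω = a then p ω else 0 := by
  simp only [law, prob_eq_sum_ite, Set.mem_ofPred_eq]

theorem sum_law_mul (p : Ω → ℝ) (f : Ω → A) (h : A → ℝ) :
    ∑ a, law p f a * h a = ∑ ω, p ω * h (f ω) := by
  classical
  simp only [law_eq_sum_ite, Finset.sum_mul]
  rw [Finset.sum_comm]
  refine Finset.sum_congr rfl fun ω _ => ?_
  simp [ite_mul]

theorem le_law {p : Ω → ℝ} (hp : ∀ ω, 0 ≤ p ω) (f : Ω → A) (ω : Ω) : p ω ≤ law p f (f ω) := by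
  classical
  rw [law_eq_sum_ite]
  refine le_trans (by simp) (Finset.single_le_sum (f := fun x => if f x = f ω then p x else 0)
    (fun x _ => ?_) (Finset.mem_univ ω))
  split_ifs
  exacts [hp x, le_rfl]

theorem sum_law_pair (p : Ω → ℝ) (f : Ω → A) (g : Ω → C) (c : C) :
    ∑ a, law p (fun ω => (f ω, g ω)) (a, c) = law p g c := by
  classical
  simp only [law_eq_sum_ite]
  rw [Finset.sum_comm]
  refine Finset.sum_congr rfl fun ω _ => ?_
  by_cases h : g ω = c <;> simp [h]

theorem law_pair_le {p : Ω → ℝ} (hp : ∀ ω, 0 ≤ p ω) (f : Ω → A) (g : Ω → C) (a : A) (c : C) :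
    law p (fun ω => (f ω, g ω)) (a, c) ≤ law p g c := by
  rw [← sum_law_pair p f g c]
  exact Finset.single_le_sum (f := fun a => law p (fun ω => (f ω, g ω)) (a, c))
    (fun _ _ => law_nonneg hp _ _) (Finset.mem_univ a)

/-- The conditional probability `Prob[f = a | g = c]`, zero when `g = c` has probability zero. -/
noncomputable def condLaw (p : Ω → ℝ) (f : Ω → A) (g : Ω → C) (a : A) (c : C) : ℝ :=
  law p (fun ω => (f ω, g ω)) (a, c) / law p g c

theorem condLaw_nonneg {p : Ω → ℝ} (hp : ∀ ω, 0 ≤ p ω) (f : Ω → A) (g : Ω → C) (a : A) (c : C) :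
    0 ≤ condLaw p f g a c :=
  div_nonneg (law_nonneg hp _ _) (law_nonneg hp _ _)

theorem condLaw_pos {p : Ω → ℝ} (hp : ∀ ω, 0 ≤ p ω) (f : Ω → A) (g : Ω → C) {ω : Ω}
    (h : 0 < p ω) : 0 < condLaw p f g (f ω) (g ω) :=
  div_pos (h.trans_le (le_law hp (fun ω => (f ω, g ω)) ω)) (h.trans_le (le_law hp g ω))

theorem condLaw_le_one {p : Ω → ℝ} (hp : ∀ ω, 0 ≤ p ω) (f : Ω → A) (g : Ω → C) (a : A) (c : C) :
    condLaw p f g a c ≤ 1 :=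
  div_le_one_of_le₀ (law_pair_le hp f g a c) (law_nonneg hp _ _)

theorem sum_condLaw_le (p : Ω → ℝ) (f : Ω → A) (g : Ω → C) (c : C) :
    ∑ a, condLaw p f g a c ≤ 1 := by
  simp only [condLaw]
  rw [← Finset.sum_div, sum_law_pair]
  exact div_self_le_one _

theorem condEntropy_eq_sum (p : Ω → ℝ) (f : Ω → A) (g : Ω → C) :
    condEntropy p f g = -∑ ω, p ω * Real.logb 2 (condLaw p f g (f ω) (g ω)) := by
  have := sum_law_mul p (fun ω => (f ω, g ω)) (fun x => Real.logb 2 (condLaw p f g x.1 x.2))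
  rw [Fintype.sum_prod_type] at this
  rw [← this]
  rfl

theorem condEntropy_nonneg {p : Ω → ℝ} (hp : ∀ ω, 0 ≤ p ω) (f : Ω → A) (g : Ω → C) :
    0 ≤ condEntropy p f g := by
  rw [condEntropy_eq_sum, neg_nonneg]
  exact Finset.sum_nonpos fun ω _ => mul_nonpos_of_nonneg_of_nonpos (hp ω)
    (Real.logb_nonpos one_lt_two (condLaw_nonneg hp _ _ _ _) (condLaw_le_one hp _ _ _ _))

variable {ι : Type*} [Fintype ι] [DecidableEq ι]

theorem law_iidLaw (p : Ω → ℝ) (f : Ω → A) (a : ι → A) :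
    law (iidLaw p) (fun ω : ι → Ω => fun i => f (ω i)) a = ∏ i, law p f (a i) := by
  classical
  simp only [law_eq_sum_ite]
  rw [← sum_pi_prod (fun i ω => if f ω = a i then p ω else 0)]
  refine Finset.sum_congr rfl fun ω _ => ?_
  rw [Finset.prod_ite_zero]
  simp [funext_iff, iidLaw]

theorem law_iidLaw_pair (p : Ω → ℝ) (f : Ω → A) (g : Ω → C) (a : ι → A) (c : ι → C) :
    law (iidLaw p) (fun ω : ι → Ω => (fun i => f (ω i), fun i => g (ω i))) (a, c) =
      ∏ i, law p (fun ω => (f ω, g ω)) (a i, c i) := by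
  rw [← law_iidLaw p (fun ω => (f ω, g ω)) (fun i => (a i, c i))]
  unfold law
  congr 1
  ext ω
  simp [funext_iff, forall_and]

theorem condLaw_iidLaw (p : Ω → ℝ) (f : Ω → A) (g : Ω → C) (a : ι → A) (c : ι → C) :
    condLaw (iidLaw p) (fun ω : ι → Ω => fun i => f (ω i)) (fun ω i => g (ω i)) a c =
      ∏ i, condLaw p f g (a i) (c i) := by
  simp only [condLaw]
  rw [law_iidLaw_pair, law_iidLaw, Finset.prod_div_distrib]

theorem condLaw_equiv (e : Ω' ≃ Ω) (p : Ω → ℝ) (f : Ω → A) (g : Ω → C) (a : A) (c : C) :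
    condLaw (fun ω => p (e ω)) (fun ω => f (e ω)) (fun ω => g (e ω)) a c = condLaw p f g a c := by
  unfold condLaw law
  congr 1
  · exact prob_equiv e p {ω | (f ω, g ω) = (a, c)}
  · exact prob_equiv e p {ω | g ω = c}

end Prob

/-! ### The weak law of large numbers for log-likelihoods -/

section WeakLaw

variable {Ω : Type*} [Fintype Ω]

/-- Chebyshev's inequality for sums of independent identically distributed variables. -/
theorem prob_iidLaw_deviation_le {p : Ω → ℝ} (hp : ∀ ω, 0 ≤ p ω) (h1 : ∑ ω, p ω = 1)
    (g : Ω → ℝ) {δ : ℝ} (hδ : 0 < δ) {n : ℕ} (hn : 0 < n) :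
    prob (iidLaw p) {ω : Fin n → Ω | n * δ ≤ |∑ i, g (ω i) - n * ∑ ω, p ω * g ω|} ≤
      (∑ ω, p ω * (g ω - ∑ ω, p ω * g ω) ^ 2) / δ ^ 2 / n := by
  classical
  set μ := ∑ ω, p ω * g ω with hμ
  have hn' : (0 : ℝ) < n := by exact_mod_cast hn
  have h2 := sum_iidLaw_mul_sq h1 (fun (_ : Fin n) ω => g ω - μ) (fun _ => by
    simp only [mul_sub, Finset.sum_sub_distrib]
    rw [← Finset.sum_mul, h1, ← hμ]
    ring)
  simp only [Finset.sum_const, Finset.card_univ, Fintype.card_fin, nsmul_eq_mul,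
    Finset.sum_sub_distrib] at h2
  have h3 : prob (iidLaw p) {ω : Fin n → Ω | n * δ ≤ |∑ i, g (ω i) - n * μ|} * (n * δ) ^ 2 ≤
      ∑ s : Fin n → Ω, iidLaw p s * (∑ i, g (s i) - n * μ) ^ 2 := by
    rw [prob_eq_sum_ite, Finset.sum_mul]
    refine Finset.sum_le_sum fun s _ => ?_
    have h0 := iidLaw_nonneg hp s
    split_ifs with h
    · have h' : n * δ ≤ |∑ i, g (s i) - n * μ| := h
      refine mul_le_mul_of_nonneg_left ?_ h0
      rw [← sq_abs (∑ i, g (s i) - n * μ)]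
      exact pow_le_pow_left₀ (by positivity) h' 2
    · rw [zero_mul]
      positivity
  rw [h2] at h3
  rw [div_div, le_div_iff₀ (by positivity)]
  have h4 : (0 : ℝ) < n := hn'
  refine le_of_mul_le_mul_right ?_ h4
  calc _ = prob (iidLaw p) {ω : Fin n → Ω | n * δ ≤ |∑ i, g (ω i) - n * μ|} * (n * δ) ^ 2 := by
        ring
    _ ≤ _ := h3
    _ = _ := by ring

theorem eventually_prob_iidLaw_deviation_le {p : Ω → ℝ} (hp : ∀ ω, 0 ≤ p ω)
    (h1 : ∑ ω, p ω = 1) (g : Ω → ℝ) {δ ε : ℝ} (hδ : 0 < δ) (hε : 0 < ε) :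
    ∀ᶠ n : ℕ in Filter.atTop,
      prob (iidLaw p) {ω : Fin n → Ω | n * δ ≤ |∑ i, g (ω i) - n * ∑ ω, p ω * g ω|} ≤ ε := by
  have h2 := tendsto_const_div_atTop_nhds_zero_nat
    ((∑ ω, p ω * (g ω - ∑ ω, p ω * g ω) ^ 2) / δ ^ 2)
  filter_upwards [h2.eventually (eventually_lt_nhds hε), Filter.eventually_gt_atTop 0]
    with n hn hn0
  exact (prob_iidLaw_deviation_le hp h1 g hδ hn0).trans hn.le

theorem iidLaw_pos_imp {ι : Type*} [Fintype ι] {p : Ω → ℝ} (hp : ∀ ω, 0 ≤ p ω) {s : ι → Ω}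
    (h : 0 < iidLaw p s) (i : ι) : 0 < p (s i) :=
  (hp _).lt_of_ne' fun h0 => h.ne' (Finset.prod_eq_zero (Finset.mem_univ i) h0)

theorem logb_prod_of_iidLaw_pos {p : Ω → ℝ} (hp : ∀ ω, 0 ≤ p ω) {r : Ω → ℝ}
    (hr : ∀ ω, 0 < p ω → 0 < r ω) {n : ℕ} {s : Fin n → Ω} (h : 0 < iidLaw p s) :
    0 < ∏ i, r (s i) ∧ Real.logb 2 (∏ i, r (s i)) = ∑ i, Real.logb 2 (r (s i)) := by
  have hpos : ∀ i, 0 < r (s i) := fun i => hr _ (iidLaw_pos_imp hp h i)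
  exact ⟨Finset.prod_pos fun i _ => hpos i, Real.logb_prod _ _ fun i _ => (hpos i).ne'⟩

/-- The logarithm of the product is a sum of i.i.d. terms. Leaving `r` general serves every
conditional law needed for decoding. -/
theorem eventually_prob_prod_lt_le {p : Ω → ℝ} (hp : ∀ ω, 0 ≤ p ω) (h1 : ∑ ω, p ω = 1)
    {r : Ω → ℝ} (hr : ∀ ω, 0 < p ω → 0 < r ω) {δ ε : ℝ} (hδ : 0 < δ) (hε : 0 < ε) :
    ∀ᶠ n : ℕ in Filter.atTop, prob (iidLaw p) {s : Fin n → Ω |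
      ∏ i, r (s i) < (2 : ℝ) ^ (-(n * (-∑ ω, p ω * Real.logb 2 (r ω) + δ)))} ≤ ε := by
  filter_upwards [eventually_prob_iidLaw_deviation_le hp h1 (fun ω => Real.logb 2 (r ω)) hδ hε]
    with n hn
  refine (prob_mono (iidLaw_nonneg hp) fun s hs h => ?_).trans hn
  obtain ⟨h0, h2⟩ := logb_prod_of_iidLaw_pos hp hr hs
  have h3 := (Real.logb_lt_iff_lt_rpow one_lt_two h0).2 h
  rw [h2] at h3
  rw [Set.mem_ofPred_eq]
  refine le_trans ?_ (neg_le_abs _)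
  linarith

theorem eventually_prob_lt_prod_le {p : Ω → ℝ} (hp : ∀ ω, 0 ≤ p ω) (h1 : ∑ ω, p ω = 1)
    {r : Ω → ℝ} (hr : ∀ ω, 0 < p ω → 0 < r ω) {δ ε : ℝ} (hδ : 0 < δ) (hε : 0 < ε) :
    ∀ᶠ n : ℕ in Filter.atTop, prob (iidLaw p) {s : Fin n → Ω |
      (2 : ℝ) ^ (-(n * (-∑ ω, p ω * Real.logb 2 (r ω) - δ))) < ∏ i, r (s i)} ≤ ε := by
  filter_upwards [eventually_prob_iidLaw_deviation_le hp h1 (fun ω => Real.logb 2 (r ω)) hδ hε]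
    with n hn
  refine (prob_mono (iidLaw_nonneg hp) fun s hs h => ?_).trans hn
  obtain ⟨h0, h2⟩ := logb_prod_of_iidLaw_pos hp hr hs
  have h3 := (Real.lt_logb_iff_rpow_lt one_lt_two h0).2 h
  rw [h2] at h3
  rw [Set.mem_ofPred_eq]
  refine le_trans ?_ (le_abs_self _)
  linarith

end WeakLaw

/-! ### Random binning with side information -/

section RandomBinning

variable {Ω A C K : Type*} [Fintype Ω] [Fintype A] [DecidableEq A] [Fintype C] [Fintype K]

/-- The uniform probability function. -/
noncomputable def unif (K : Type*) [Fintype K] : K → ℝ := fun _ => (Fintype.card K : ℝ)⁻¹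

theorem unif_nonneg (k : K) : 0 ≤ unif K k := by
  unfold unif
  positivity

theorem sum_unif [Nonempty K] : ∑ k, unif K k = 1 := by
  simp [unif]

/-- The set of outcomes on which `f` may fail to be recovered from its bin `b (f ω)` and the side
information `g ω` by looking for a value of conditional probability at least `τ`. -/
def binFail (p : Ω → ℝ) (f : Ω → A) (g : Ω → C) (τ : ℝ) (b : A → K) : Set Ω :=
  {ω | condLaw p f g (f ω) (g ω) < τ} ∪
    {ω | ∃ a, a ≠ f ω ∧ b a = b (f ω) ∧ τ ≤ condLaw p f g a (g ω)}

theorem exists_decoder [Nonempty A] (p : Ω → ℝ) (f : Ω → A) (g : Ω → C) (τ : ℝ) (b : A → K) :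
    ∃ d : K → C → A, ∀ ω, ω ∉ binFail p f g τ b → d (b (f ω)) (g ω) = f ω := by
  classical
  -- Any likely value in the bin is chosen; outside `binFail` the true value is the only one. The
  -- default value is never used there.
  refine ⟨fun k c => if h : ∃ a, b a = k ∧ τ ≤ condLaw p f g a c then h.choose
    else Classical.arbitrary A, fun ω hω => ?_⟩
  simp only [binFail, Set.mem_union, Set.mem_ofPred_eq, not_or, not_lt, not_exists, not_and,
    not_le] at hω
  have h : ∃ a, b a = b (f ω) ∧ τ ≤ condLaw p f g a (g ω) := ⟨f ω, rfl, hω.1⟩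
  change (if h : ∃ a, b a = b (f ω) ∧ τ ≤ condLaw p f g a (g ω) then h.choose
    else Classical.arbitrary A) = f ω
  rw [dif_pos h]
  by_contra hne
  exact (hω.2 _ hne h.choose_spec.1).not_ge h.choose_spec.2

-- Distinct values receive independent bins, so they collide with probability one over the number of
-- bins.
open scoped Classical in
theorem sum_unif_bin_eq [Nonempty K] {a a' : A} (h : a ≠ a') :
    ∑ b : A → K, iidLaw (unif K) b * (if b a = b a' then 1 else 0) = (Fintype.card K : ℝ)⁻¹ := by
  have key : ∀ b : A → K, iidLaw (unif K) b * (if b a = b a' then (1 : ℝ) else 0) =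
      ∑ k, iidLaw (unif K) b * ((if b a = k then 1 else 0) * (if b a' = k then 1 else 0)) := by
    intro b
    rw [← Finset.mul_sum]
    congr 1
    simp [eq_comm]
  simp only [key]
  rw [Finset.sum_comm]
  have : ∀ k : K, ∑ b : A → K, iidLaw (unif K) b *
      ((if b a = k then 1 else 0) * (if b a' = k then 1 else 0)) =
      (Fintype.card K : ℝ)⁻¹ * (Fintype.card K : ℝ)⁻¹ := by
    intro k
    rw [sum_iidLaw_mul_mul sum_unif h (fun x => if x = k then 1 else 0)
      (fun x => if x = k then 1 else 0)]
    simp [unif]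
  rw [Finset.sum_congr rfl fun k _ => this k]
  simp

/-- Conditional probabilities sum to at most one, so at most `τ⁻¹` of them reach `τ`. -/
theorem card_condLaw_le {p : Ω → ℝ} (hp : ∀ ω, 0 ≤ p ω) (f : Ω → A) (g : Ω → C) {τ : ℝ}
    (hτ : 0 < τ) (c : C) :
    ∑ a, (if τ ≤ condLaw p f g a c then (1 : ℝ) else 0) ≤ τ⁻¹ := by
  calc ∑ a, (if τ ≤ condLaw p f g a c then (1 : ℝ) else 0)
      ≤ ∑ a, condLaw p f g a c * τ⁻¹ := by
        refine Finset.sum_le_sum fun a _ => ?_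
        have := condLaw_nonneg hp f g a c
        split_ifs with h
        · rwa [← div_eq_mul_inv, one_le_div hτ]
        · positivity
    _ ≤ τ⁻¹ := by
        rw [← Finset.sum_mul]
        exact mul_le_of_le_one_left (by positivity) (sum_condLaw_le p f g c)

/-- Decoding from a uniformly random bin with side information. -/
theorem avg_prob_binFail_le [Nonempty K] {p : Ω → ℝ} (hp : ∀ ω, 0 ≤ p ω) (h1 : ∑ ω, p ω = 1)
    (f : Ω → A) (g : Ω → C) {τ : ℝ} (hτ : 0 < τ) :
    ∑ b : A → K, iidLaw (unif K) b * prob p (binFail p f g τ b) ≤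
      prob p {ω | condLaw p f g (f ω) (g ω) < τ} + (Fintype.card K : ℝ)⁻¹ * τ⁻¹ := by
  classical
  -- Union bound over the wrong candidates sharing the bin of the true value.
  have hcol : ∀ b : A → K,
      prob p {ω | ∃ a, a ≠ f ω ∧ b a = b (f ω) ∧ τ ≤ condLaw p f g a (g ω)} ≤
      ∑ ω, p ω * ∑ a, (if τ ≤ condLaw p f g a (g ω) then
        (if a ≠ f ω then (if b a = b (f ω) then 1 else 0) else 0) else 0) := by
    intro b
    rw [prob_eq_sum_ite]
    refine Finset.sum_le_sum fun ω _ => ?_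
    have hnn : ∀ a, (0 : ℝ) ≤ (if τ ≤ condLaw p f g a (g ω) then
        (if a ≠ f ω then (if b a = b (f ω) then 1 else 0) else 0) else 0) := by
      intro a
      split_ifs <;> norm_num
    split_ifs with h
    · obtain ⟨a, ha1, ha2, ha3⟩ := h
      refine le_mul_of_one_le_right (hp ω) (le_trans ?_
        (Finset.single_le_sum (fun a _ => hnn a) (Finset.mem_univ a)))
      simp [ha1, ha2, ha3]
    · exact mul_nonneg (hp ω) (Finset.sum_nonneg fun a _ => hnn a)
  calc ∑ b : A → K, iidLaw (unif K) b * prob p (binFail p f g τ b)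
      ≤ ∑ b : A → K, iidLaw (unif K) b * (prob p {ω | condLaw p f g (f ω) (g ω) < τ} +
        ∑ ω, p ω * ∑ a, (if τ ≤ condLaw p f g a (g ω) then
        (if a ≠ f ω then (if b a = b (f ω) then 1 else 0) else 0) else 0)) := by
        refine Finset.sum_le_sum fun b _ => mul_le_mul_of_nonneg_left ?_
          (iidLaw_nonneg unif_nonneg b)
        exact (prob_union_le hp _ _).trans (by gcongr; exact hcol b)
    _ = prob p {ω | condLaw p f g (f ω) (g ω) < τ} +
        ∑ ω, p ω * ∑ a, (if τ ≤ condLaw p f g a (g ω) then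
        (if a ≠ f ω then (Fintype.card K : ℝ)⁻¹ else 0) else 0) := by
        simp only [mul_add, Finset.sum_add_distrib]
        rw [← Finset.sum_mul, sum_iidLaw sum_unif, one_mul]
        congr 1
        simp only [Finset.mul_sum]
        rw [Finset.sum_comm]
        refine Finset.sum_congr rfl fun ω _ => ?_
        rw [Finset.sum_comm]
        refine Finset.sum_congr rfl fun a _ => ?_
        by_cases h : τ ≤ condLaw p f g a (g ω)
        · by_cases h' : a ≠ f ω
          · simp only [if_pos h, if_pos h']
            rw [← sum_unif_bin_eq h', Finset.mul_sum]
            exact Finset.sum_congr rfl fun b _ => by ring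
          · simp [h']
        · simp [h]
    _ ≤ _ := by
        gcongr
        calc _ ≤ ∑ ω, p ω * ((Fintype.card K : ℝ)⁻¹ * τ⁻¹) := by
              refine Finset.sum_le_sum fun ω _ => mul_le_mul_of_nonneg_left ?_ (hp ω)
              refine le_trans ?_ (mul_le_mul_of_nonneg_left (card_condLaw_le hp f g hτ (g ω))
                (by positivity))
              rw [Finset.mul_sum]
              refine Finset.sum_le_sum fun a _ => ?_
              split_ifs <;> simp
          _ = _ := by rw [← Finset.sum_mul, h1, one_mul]

end RandomBinning

/-! ### Near-uniformity of a random bin index -/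

section Resolvability

variable {W F M : Type*} [Fintype W] [DecidableEq W] [Fintype F] [Fintype M]

open scoped Classical in
/-- The amount by which the law of the first bin index of a variable with law `κ` falls short of
the uniform law. -/
noncomputable def binDeficit (κ : W → ℝ) (b : W → F × M) : ℝ :=
  ∑ f, max 0 ((Fintype.card F : ℝ)⁻¹ - ∑ w, κ w * (if (b w).1 = f then 1 else 0))

theorem binDeficit_eq_zero_of_subsingleton [Unique F] {κ : W → ℝ} (h1 : ∑ w, κ w = 1)
    (b : W → F × M) : binDeficit κ b = 0 := by
  classical
  have : ∀ w, (b w).1 = default := fun w => Unique.eq_default _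
  simp [binDeficit, h1, this]

/-- A linear substitute for Cauchy–Schwarz: a variance bound controls a mean absolute deviation
without square roots. -/
theorem abs_le_add_sq_div {α : ℝ} (hα : 0 < α) (t : ℝ) : |t| ≤ α + t ^ 2 / α := by
  rw [← sq_abs, ← sub_nonneg]
  have : α + |t| ^ 2 / α - |t| = ((α - |t|) ^ 2 + α * |t|) / α := by
    field_simp
    ring
  rw [this]
  positivity

theorem sum_unif_fst_eq [DecidableEq F] [Nonempty M] (f : F) :
    ∑ k : F × M, unif (F × M) k * (if k.1 = f then 1 else 0) = (Fintype.card F : ℝ)⁻¹ := by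
  rw [Fintype.sum_prod_type, Finset.sum_eq_single f]
  · simp [unif]
  · intro x _ hx
    simp [hx]
  · simp

theorem sum_unif_fst_sub_sq_le [DecidableEq F] [Nonempty F] [Nonempty M] (f : F) :
    ∑ k : F × M, unif (F × M) k * ((if k.1 = f then 1 else 0) - (Fintype.card F : ℝ)⁻¹) ^ 2 ≤
      (Fintype.card F : ℝ)⁻¹ := by
  set r : ℝ := (Fintype.card F : ℝ)⁻¹
  have : ∀ k : F × M, unif (F × M) k * ((if k.1 = f then 1 else 0) - r) ^ 2 =
      unif (F × M) k * (if k.1 = f then 1 else 0) * (1 - 2 * r) + unif (F × M) k * r ^ 2 := by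
    intro k
    split_ifs <;> ring
  simp only [this, Finset.sum_add_distrib, ← Finset.sum_mul]
  rw [sum_unif_fst_eq, sum_unif]
  nlinarith [sq_nonneg r]

/-- For a random binning the first bin index of a variable, none of whose likely values has
probability above `θ`, is nearly uniform. -/
theorem avg_binDeficit_le [Nonempty F] [Nonempty M] {κ : W → ℝ} (hκ : ∀ w, 0 ≤ κ w)
    (h1 : ∑ w, κ w = 1) {θ η : ℝ} (hθ : 0 ≤ θ) (hη : 0 < η) :
    ∑ b : W → F × M, iidLaw (unif (F × M)) b * binDeficit κ b ≤
      prob κ {w | θ < κ w} + η + Fintype.card F * θ / η := by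
  classical
  obtain ⟨N, hN⟩ : ∃ N : ℝ, N = (Fintype.card F : ℝ) := ⟨_, rfl⟩
  have hNpos : 0 < N := by
    rw [hN]
    exact_mod_cast Fintype.card_pos
  -- Discard the values heavier than `θ`. The lost mass is the first error term, and the remaining
  -- squares sum to at most `θ`.
  obtain ⟨κ', hκ'⟩ : ∃ κ' : W → ℝ, ∀ w, κ' w = if θ < κ w then 0 else κ w := ⟨_, fun _ => rfl⟩
  have hκ'le : ∀ w, κ' w ≤ κ w := fun w => by
    rw [hκ']
    split_ifs
    exacts [hκ w, le_rfl]
  have hκ'sq : ∀ w, κ' w ^ 2 ≤ θ * κ w := fun w => by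
    rw [hκ']
    split_ifs with h
    · rw [zero_pow two_ne_zero]
      exact mul_nonneg hθ (hκ w)
    · rw [sq]
      exact mul_le_mul_of_nonneg_right (not_lt.1 h) (hκ w)
  have hprob : prob κ {w | θ < κ w} = 1 - ∑ w, κ' w := by
    rw [prob_eq_sum_ite, ← h1, ← Finset.sum_sub_distrib]
    refine Finset.sum_congr rfl fun w _ => ?_
    rw [hκ', Set.mem_ofPred_eq]
    split_ifs <;> ring
  set h : F → W → F × M → ℝ := fun f w k => κ' w * ((if k.1 = f then 1 else 0) - N⁻¹) with hh
  have hmean : ∀ f w, ∑ k, unif (F × M) k * h f w k = 0 := by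
    intro f w
    have : ∀ k : F × M, unif (F × M) k * h f w k =
        κ' w * (unif (F × M) k * (if k.1 = f then 1 else 0) - unif (F × M) k * N⁻¹) := by
      intro k
      simp only [hh]
      ring
    simp only [this]
    rw [← Finset.mul_sum, Finset.sum_sub_distrib, sum_unif_fst_eq, ← Finset.sum_mul, sum_unif, hN]
    ring
  have hvar : ∀ f, ∑ b : W → F × M, iidLaw (unif (F × M)) b * (∑ w, h f w (b w)) ^ 2 ≤
      θ * N⁻¹ := by
    intro f
    rw [sum_iidLaw_mul_sq sum_unif (h f) (hmean f)]
    calc _ ≤ ∑ w, θ * κ w * N⁻¹ := by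
          refine Finset.sum_le_sum fun w _ => ?_
          have : ∀ k : F × M, unif (F × M) k * h f w k ^ 2 =
              κ' w ^ 2 * (unif (F × M) k * ((if k.1 = f then 1 else 0) - N⁻¹) ^ 2) := by
            intro k
            simp only [hh]
            ring
          simp only [this]
          rw [← Finset.mul_sum]
          refine mul_le_mul (hκ'sq w) ?_ ?_ (mul_nonneg hθ (hκ w))
          · rw [hN]
            exact sum_unif_fst_sub_sq_le f
          · exact Finset.sum_nonneg fun k _ => mul_nonneg (unif_nonneg k) (sq_nonneg _)
      _ = θ * N⁻¹ := by rw [← Finset.sum_mul, ← Finset.mul_sum, h1, mul_one]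
  have hpt : ∀ (b : W → F × M) f,
      max 0 (N⁻¹ - ∑ w, κ w * (if (b w).1 = f then 1 else 0)) ≤
      ((1 - ∑ w, κ' w) * N⁻¹ + η * N⁻¹) + (∑ w, h f w (b w)) ^ 2 * (N / η) := by
    intro b f
    -- The choice `α = η / N` makes the constant terms add up to `η` over the `N` bins.
    have habs := abs_le_add_sq_div (α := η * N⁻¹) (by positivity) (∑ w, h f w (b w))
    have e1 : (∑ w, h f w (b w)) ^ 2 / (η * N⁻¹) = (∑ w, h f w (b w)) ^ 2 * (N / η) := by
      field_simp
    rw [e1] at habs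
    have e2 : ∑ w, h f w (b w) = ∑ w, κ' w * (if (b w).1 = f then 1 else 0) -
        (∑ w, κ' w) * N⁻¹ := by
      rw [Finset.sum_mul, ← Finset.sum_sub_distrib]
      exact Finset.sum_congr rfl fun w _ => by simp only [hh]; ring
    have e3 : ∑ w, κ' w * (if (b w).1 = f then (1 : ℝ) else 0) ≤
        ∑ w, κ w * (if (b w).1 = f then 1 else 0) := by
      refine Finset.sum_le_sum fun w _ => mul_le_mul_of_nonneg_right (hκ'le w) ?_
      split_ifs <;> norm_num
    have e4 : 0 ≤ (1 - ∑ w, κ' w) * N⁻¹ := by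
      rw [← hprob]
      exact mul_nonneg (prob_nonneg hκ _) (by positivity)
    refine max_le ?_ ?_
    · positivity
    · have := neg_le_abs (∑ w, h f w (b w))
      nlinarith
  calc _ ≤ ∑ b : W → F × M, iidLaw (unif (F × M)) b * ∑ f : F,
        (((1 - ∑ w, κ' w) * N⁻¹ + η * N⁻¹) + (∑ w, h f w (b w)) ^ 2 * (N / η)) := by
        refine Finset.sum_le_sum fun b _ => mul_le_mul_of_nonneg_left ?_
          (iidLaw_nonneg unif_nonneg b)
        unfold binDeficit
        rw [← hN]
        exact Finset.sum_le_sum fun f _ => hpt b f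
    _ = ∑ f : F, (((1 - ∑ w, κ' w) * N⁻¹ + η * N⁻¹) +
        (∑ b : W → F × M, iidLaw (unif (F × M)) b * (∑ w, h f w (b w)) ^ 2) * (N / η)) := by
        simp only [Finset.mul_sum]
        rw [Finset.sum_comm]
        refine Finset.sum_congr rfl fun f _ => ?_
        simp only [mul_add _ ((1 - ∑ w, κ' w) * N⁻¹ + η * N⁻¹), Finset.sum_add_distrib]
        rw [← Finset.sum_mul, sum_iidLaw sum_unif, one_mul, Finset.sum_mul]
        congr 1
        exact Finset.sum_congr rfl fun b _ => by ring
    _ ≤ ∑ f : F, (((1 - ∑ w, κ' w) * N⁻¹ + η * N⁻¹) + θ * N⁻¹ * (N / η)) := by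
        refine Finset.sum_le_sum fun f _ => ?_
        gcongr
        exact hvar f
    _ = _ := by
        rw [Finset.sum_const, Finset.card_univ, nsmul_eq_mul, ← hN, hprob]
        field_simp

end Resolvability

/-! ### The one-shot code -/

section OneShot

variable {S Z W F M : Type*} [Fintype S] [Fintype Z] [Fintype W] [Fintype F] [Fintype M]

open scoped Classical in
theorem sum_sum_fiber (z : S → Z) (h : Z → S → ℝ) :
    ∑ ζ, ∑ s, (if z s = ζ then h ζ s else 0) = ∑ s, h (z s) s := by
  rw [Finset.sum_comm]
  simp

/-- Replacing a random index, generated from `z` by the test channel `κ` followed by the binning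
`b`, by a deterministic function of `z` for a fixed value of the first bin index. -/
theorem exists_deterministic_index [Nonempty F] [Nonempty M] {P : S → ℝ} (hP : ∀ s, 0 ≤ P s)
    (z : S → Z) {κ : Z → W → ℝ} (hκ : ∀ ζ w, 0 ≤ κ ζ w) (b : W → F × M) {G : F → M → S → ℝ}
    (hG0 : ∀ f m s, 0 ≤ G f m s) {c : ℝ} (hGc : ∀ f m s, G f m s ≤ c) :
    ∃ (f : F) (m : Z → M), ∑ s, P s * G f (m (z s)) s ≤
      ∑ w, ∑ s, κ (z s) w * P s * G (b w).1 (b w).2 s +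
        c * ∑ s, P s * binDeficit (κ (z s)) b := by
  classical
  set g : Z → F → M → ℝ := fun ζ f m => ∑ s, if z s = ζ then P s * G f m s else 0 with hg
  -- The best second index for each source value and each `f` costs no more than a random one.
  have hmin : ∀ ζ f, ∃ m, ∀ m', g ζ f m ≤ g ζ f m' := fun ζ f => Finite.exists_min (g ζ f)
  choose m hm using hmin
  have hg0 : ∀ ζ f m, 0 ≤ g ζ f m := fun ζ f m => Finset.sum_nonneg fun s _ => by
    split_ifs
    exacts [mul_nonneg (hP s) (hG0 f m s), le_rfl]
  have hgc : ∀ ζ f m, g ζ f m ≤ ∑ s, if z s = ζ then P s * c else 0 := by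
    intro ζ f m
    refine Finset.sum_le_sum fun s _ => ?_
    split_ifs
    exacts [mul_le_mul_of_nonneg_left (hGc f m s) (hP s), le_rfl]
  set N : ℝ := (Fintype.card F : ℝ)⁻¹ with hN
  set I : F → W → ℝ := fun f w => if (b w).1 = f then 1 else 0 with hI
  have hI0 : ∀ f w, 0 ≤ I f w := fun f w => by
    simp only [hI]
    split_ifs <;> norm_num
  -- The uniform weight `N` is at most the true mass of bin `f` plus the deficit. On the mass,
  -- minimality of `m ζ f` compares with the random index; on the deficit, the cost is at most `c`.
  have hpt : ∀ ζ f, N * g ζ f (m ζ f) ≤ ∑ w, κ ζ w * I f w * g ζ f (b w).2 +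
      max 0 (N - ∑ w, κ ζ w * I f w) * ∑ s, if z s = ζ then P s * c else 0 := by
    intro ζ f
    have e1 : (∑ w, κ ζ w * I f w) * g ζ f (m ζ f) ≤ ∑ w, κ ζ w * I f w * g ζ f (b w).2 := by
      rw [Finset.sum_mul]
      exact Finset.sum_le_sum fun w _ =>
        mul_le_mul_of_nonneg_left (hm ζ f _) (mul_nonneg (hκ ζ w) (hI0 f w))
    have e2 : (N - ∑ w, κ ζ w * I f w) * g ζ f (m ζ f) ≤
        max 0 (N - ∑ w, κ ζ w * I f w) * ∑ s, if z s = ζ then P s * c else 0 :=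
      (mul_le_mul_of_nonneg_right (le_max_right _ _) (hg0 _ _ _)).trans
        (mul_le_mul_of_nonneg_left (hgc _ _ _) (le_max_left _ _))
    linarith
  have hsum : ∑ f : F, N * ∑ s, P s * G f (m (z s) f) s ≤ ∑ f : F, N *
      (∑ w, ∑ s, κ (z s) w * P s * G (b w).1 (b w).2 s +
        c * ∑ s, P s * binDeficit (κ (z s)) b) := by
    have hcard : ∑ _f : F, N = 1 := by simp [hN]
    rw [← Finset.sum_mul, hcard, one_mul]
    have e0 : ∀ f, ∑ s, P s * G f (m (z s) f) s = ∑ ζ, g ζ f (m ζ f) := fun f =>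
      (sum_sum_fiber z (fun ζ s => P s * G f (m ζ f) s)).symm
    calc _ = ∑ f, ∑ ζ, N * g ζ f (m ζ f) := by simp only [e0, Finset.mul_sum]
      _ ≤ ∑ f, ∑ ζ, (∑ w, κ ζ w * I f w * g ζ f (b w).2 +
          max 0 (N - ∑ w, κ ζ w * I f w) * ∑ s, if z s = ζ then P s * c else 0) :=
          Finset.sum_le_sum fun f _ => Finset.sum_le_sum fun ζ _ => hpt ζ f
      _ = _ := by
          simp only [Finset.sum_add_distrib]
          congr 1
          · have e1 : ∀ ζ w, ∑ f, κ ζ w * I f w * g ζ f (b w).2 =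
                ∑ s, if z s = ζ then κ ζ w * P s * G (b w).1 (b w).2 s else 0 := by
              intro ζ w
              rw [Finset.sum_eq_single (b w).1]
              · simp only [hI, if_true, mul_one, hg, Finset.mul_sum]
                exact Finset.sum_congr rfl fun s _ => by split_ifs <;> ring
              · intro f _ hf
                simp [hI, hf.symm]
              · simp
            rw [Finset.sum_comm]
            have e2 : ∀ ζ, ∑ f, ∑ w, κ ζ w * I f w * g ζ f (b w).2 =
                ∑ w, ∑ s, if z s = ζ then κ ζ w * P s * G (b w).1 (b w).2 s else 0 := by
              intro ζ
              rw [Finset.sum_comm]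
              exact Finset.sum_congr rfl fun w _ => e1 ζ w
            simp only [e2]
            rw [Finset.sum_comm]
            exact Finset.sum_congr rfl fun w _ =>
              sum_sum_fiber z (fun ζ s => κ ζ w * P s * G (b w).1 (b w).2 s)
          · rw [Finset.sum_comm]
            simp only [← Finset.sum_mul]
            have e3 := sum_sum_fiber z (fun ζ s => binDeficit (κ ζ) b * (P s * c))
            calc _ = ∑ ζ, ∑ s, (if z s = ζ then binDeficit (κ ζ) b * (P s * c) else 0) := by
                  refine Finset.sum_congr rfl fun ζ _ => ?_
                  rw [Finset.mul_sum]
                  refine Finset.sum_congr rfl fun s _ => ?_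
                  simp only [binDeficit, hI, mul_ite, mul_zero, hN]
              _ = _ := by
                  rw [e3, Finset.mul_sum]
                  exact Finset.sum_congr rfl fun s _ => by ring
  -- The bound holds on average over uniform `f`, hence for some `f`.
  obtain ⟨f, -, hf⟩ := Finset.exists_le_of_sum_le Finset.univ_nonempty hsum
  refine ⟨f, fun ζ => m ζ f, le_of_mul_le_mul_left hf ?_⟩
  rw [hN, inv_pos]
  exact_mod_cast Fintype.card_pos

theorem exists_le_of_avg_le {Θ : Type*} [Fintype Θ] {q : Θ → ℝ} (hq : ∀ t, 0 ≤ q t)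
    (h1 : ∑ t, q t = 1) {G : Θ → ℝ} {c : ℝ} (h : ∑ t, q t * G t ≤ c) : ∃ t, G t ≤ c := by
  by_contra! hc
  have h2 : ∑ t, q t * c < ∑ t, q t * G t := by
    refine Finset.sum_lt_sum (fun t _ => mul_le_mul_of_nonneg_left (hc t).le (hq t)) ?_
    have : ∃ t ∈ Finset.univ, 0 < q t := by
      apply Finset.exists_lt_of_sum_lt
      simp [h1]
    obtain ⟨t, ht, h0⟩ := this
    exact ⟨t, ht, mul_lt_mul_of_pos_left (hc t) h0⟩
  rw [← Finset.sum_mul, h1, one_mul] at h2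
  exact h2.not_ge h

variable {A B U V M₁ M₂ : Type*} [Fintype A] [Fintype B] [Fintype U] [Fintype V] [Fintype M₁]
  [Fintype M₂]

/-- The joint law of the output of the test channel `κ` and of the source. -/
noncomputable def channelLaw (P : S → ℝ) (z : S → Z) (κ : Z → W → ℝ) : W × S → ℝ :=
  fun ω => κ (z ω.2) ω.1 * P ω.2

theorem channelLaw_nonneg {P : S → ℝ} (hP : ∀ s, 0 ≤ P s) (z : S → Z) {κ : Z → W → ℝ}
    (hκ : ∀ ζ w, 0 ≤ κ ζ w) (ω : W × S) : 0 ≤ channelLaw P z κ ω :=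
  mul_nonneg (hκ _ _) (hP _)

theorem sum_channelLaw {P : S → ℝ} (h1 : ∑ s, P s = 1) (z : S → Z) {κ : Z → W → ℝ}
    (hκ1 : ∀ ζ, ∑ w, κ ζ w = 1) : ∑ ω, channelLaw P z κ ω = 1 := by
  rw [Fintype.sum_prod_type_right]
  simp [channelLaw, ← Finset.sum_mul, hκ1, h1]

/-- Under the ideal joint law, decoding errors lie in the four binning failure sets; the deficit `ρ`
pays for fixing `f`. The factor `2 * ρ` appears because the cost is a sum of two error indicators.
-/
theorem exists_one_shot_code [Nonempty W] [Nonempty A] [Nonempty B] [Nonempty F] [Nonempty M]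
    [Nonempty M₁] [Nonempty M₂] [DecidableEq W] {P : S → ℝ} (hP : ∀ s, 0 ≤ P s) (hP1 : ∑ s, P s = 1)
    (x : S → A) (y : S → B) (u : S → U) (v : S → V) {κ : A × B → W → ℝ}
    (hκ : ∀ ζ w, 0 ≤ κ ζ w) (hκ1 : ∀ ζ, ∑ w, κ ζ w = 1) {p : W × S → ℝ}
    (hp : p = channelLaw P (fun s => (x s, y s)) κ) {τ τ₁ τ₂ : ℝ} (hτ : 0 < τ) (hτ₁ : 0 < τ₁)
    (hτ₂ : 0 < τ₂) {ρ : ℝ}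
    (hρ : ∑ b : W → F × M, iidLaw (unif (F × M)) b *
      ∑ s, P s * binDeficit (κ (x s, y s)) b ≤ ρ) :
    ∃ (enc : A × B → M × M₁ × M₂) (decX : M × M₁ × U → A) (decY : M × M₂ × V → B),
      prob P {s | decX ((enc (x s, y s)).1, (enc (x s, y s)).2.1, u s) ≠ x s} +
        prob P {s | decY ((enc (x s, y s)).1, (enc (x s, y s)).2.2, v s) ≠ y s} ≤
      prob p {ω | condLaw p (fun ω => ω.1) (fun ω => u ω.2) ω.1 (u ω.2) < τ} +
      prob p {ω | condLaw p (fun ω => ω.1) (fun ω => v ω.2) ω.1 (v ω.2) < τ} +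
      2 * ((Fintype.card F * Fintype.card M : ℝ)⁻¹ * τ⁻¹) +
      (prob p {ω | condLaw p (fun ω => x ω.2) (fun ω => (ω.1, u ω.2)) (x ω.2) (ω.1, u ω.2) < τ₁} +
        (Fintype.card M₁ : ℝ)⁻¹ * τ₁⁻¹) +
      (prob p {ω | condLaw p (fun ω => y ω.2) (fun ω => (ω.1, v ω.2)) (y ω.2) (ω.1, v ω.2) < τ₂} +
        (Fintype.card M₂ : ℝ)⁻¹ * τ₂⁻¹) + 2 * ρ := by
  classical
  have hp0 : ∀ ω, 0 ≤ p ω := fun ω => hp ▸ channelLaw_nonneg hP _ hκ ω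
  have hp1 : ∑ ω, p ω = 1 := hp ▸ sum_channelLaw hP1 _ hκ1
  obtain ⟨b₁, hb₁⟩ := exists_le_of_avg_le (iidLaw_nonneg unif_nonneg) (sum_iidLaw sum_unif)
    (avg_prob_binFail_le (K := M₁) hp0 hp1 (fun ω => x ω.2) (fun ω => (ω.1, u ω.2)) hτ₁)
  obtain ⟨b₂, hb₂⟩ := exists_le_of_avg_le (iidLaw_nonneg unif_nonneg) (sum_iidLaw sum_unif)
    (avg_prob_binFail_le (K := M₂) hp0 hp1 (fun ω => y ω.2) (fun ω => (ω.1, v ω.2)) hτ₂)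
  have hU := avg_prob_binFail_le (K := F × M) hp0 hp1 (fun ω => ω.1) (fun ω => u ω.2) hτ
  have hV := avg_prob_binFail_le (K := F × M) hp0 hp1 (fun ω => ω.1) (fun ω => v ω.2) hτ
  -- The same binning of `W` must serve both receivers and have a small deficit, so the three
  -- averages are bounded jointly before a binning is picked.
  have havg : ∑ b : W → F × M, iidLaw (unif (F × M)) b *
      (prob p (binFail p (fun ω => ω.1) (fun ω => u ω.2) τ b) +
        prob p (binFail p (fun ω => ω.1) (fun ω => v ω.2) τ b) +
        2 * ∑ s, P s * binDeficit (κ (x s, y s)) b) =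
      ∑ b : W → F × M, iidLaw (unif (F × M)) b *
        prob p (binFail p (fun ω => ω.1) (fun ω => u ω.2) τ b) +
      ∑ b : W → F × M, iidLaw (unif (F × M)) b *
        prob p (binFail p (fun ω => ω.1) (fun ω => v ω.2) τ b) +
      2 * ∑ b : W → F × M, iidLaw (unif (F × M)) b *
        ∑ s, P s * binDeficit (κ (x s, y s)) b := by
    rw [Finset.mul_sum, ← Finset.sum_add_distrib, ← Finset.sum_add_distrib]
    exact Finset.sum_congr rfl fun b _ => by ring
  obtain ⟨b, hb⟩ := exists_le_of_avg_le (iidLaw_nonneg unif_nonneg) (sum_iidLaw sum_unif)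
    (havg.trans_le (add_le_add (add_le_add hU hV) (mul_le_mul_of_nonneg_left hρ zero_le_two)))
  obtain ⟨dU, hdU⟩ := exists_decoder p (fun ω => ω.1) (fun ω => u ω.2) τ b
  obtain ⟨dV, hdV⟩ := exists_decoder p (fun ω => ω.1) (fun ω => v ω.2) τ b
  obtain ⟨dX, hdX⟩ := exists_decoder p (fun ω => x ω.2) (fun ω => (ω.1, u ω.2)) τ₁ b₁
  obtain ⟨dY, hdY⟩ := exists_decoder p (fun ω => y ω.2) (fun ω => (ω.1, v ω.2)) τ₂ b₂
  set GX : F → M → S → ℝ := fun f m s =>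
    if dX (b₁ (x s)) (dU (f, m) (u s), u s) ≠ x s then 1 else 0 with hGX
  set GY : F → M → S → ℝ := fun f m s =>
    if dY (b₂ (y s)) (dV (f, m) (v s), v s) ≠ y s then 1 else 0 with hGY
  obtain ⟨f, m, hfm⟩ := exists_deterministic_index hP (fun s => (x s, y s)) hκ b
    (G := fun f m s => GX f m s + GY f m s) (c := 2)
    (fun f m s => by
      simp only [hGX, hGY]
      split_ifs <;> norm_num)
    (fun f m s => by
      simp only [hGX, hGY]
      split_ifs <;> norm_num)
  refine ⟨fun ζ => (m ζ, b₁ ζ.1, b₂ ζ.2), fun t => dX t.2.1 (dU (f, t.1) t.2.2, t.2.2),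
    fun t => dY t.2.1 (dV (f, t.1) t.2.2, t.2.2), ?_⟩
  have hlhs : prob P {s | dX (b₁ (x s)) (dU (f, m (x s, y s)) (u s), u s) ≠ x s} +
      prob P {s | dY (b₂ (y s)) (dV (f, m (x s, y s)) (v s), v s) ≠ y s} =
      ∑ s, P s * (GX f (m (x s, y s)) s + GY f (m (x s, y s)) s) := by
    rw [prob_eq_sum_ite, prob_eq_sum_ite, ← Finset.sum_add_distrib]
    refine Finset.sum_congr rfl fun s _ => ?_
    simp only [hGX, hGY, Set.mem_ofPred_eq]
    split_ifs <;> ring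
  have hideal : ∑ w, ∑ s, κ (x s, y s) w * P s * (GX (b w).1 (b w).2 s + GY (b w).1 (b w).2 s) ≤
      (prob p (binFail p (fun ω => ω.1) (fun ω => u ω.2) τ b) +
        prob p (binFail p (fun ω => x ω.2) (fun ω => (ω.1, u ω.2)) τ₁ b₁)) +
      (prob p (binFail p (fun ω => ω.1) (fun ω => v ω.2) τ b) +
        prob p (binFail p (fun ω => y ω.2) (fun ω => (ω.1, v ω.2)) τ₂ b₂)) := by
    have hsplit : ∑ w, ∑ s, κ (x s, y s) w * P s *
        (GX (b w).1 (b w).2 s + GY (b w).1 (b w).2 s) =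
        prob p {ω | dX (b₁ (x ω.2)) (dU (b ω.1) (u ω.2), u ω.2) ≠ x ω.2} +
        prob p {ω | dY (b₂ (y ω.2)) (dV (b ω.1) (v ω.2), v ω.2) ≠ y ω.2} := by
      rw [prob_eq_sum_ite, prob_eq_sum_ite, ← Finset.sum_add_distrib, Fintype.sum_prod_type]
      refine Finset.sum_congr rfl fun w _ => Finset.sum_congr rfl fun s _ => ?_
      simp only [hGX, hGY, hp, channelLaw, Set.mem_ofPred_eq]
      split_ifs <;> ring
    rw [hsplit]
    refine add_le_add ((prob_mono hp0 fun ω _ hω => ?_).trans (prob_union_le hp0 _ _))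
      ((prob_mono hp0 fun ω _ hω => ?_).trans (prob_union_le hp0 _ _))
    · by_contra hc
      rw [Set.mem_union, not_or] at hc
      refine hω ?_
      have e1 := hdU ω hc.1
      have e2 := hdX ω hc.2
      rw [e1, e2]
    · by_contra hc
      rw [Set.mem_union, not_or] at hc
      refine hω ?_
      have e1 := hdV ω hc.1
      have e2 := hdY ω hc.2
      rw [e1, e2]
  dsimp only at hfm ⊢
  rw [hlhs]
  have hcard : (Fintype.card (F × M) : ℝ) = Fintype.card F * Fintype.card M := by
    rw [Fintype.card_prod]
    push_cast
    rfl
  rw [hcard] at hb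
  linarith

end OneShot

/-! ### Entropy of the test channel -/

section TestChannel

variable {S Z W C : Type*} [Fintype S] [Fintype Z] [Fintype W] [Fintype C]

/-- The conditional entropy of the output of the test channel given its input. -/
noncomputable def channelEntropy (P : S → ℝ) (z : S → Z) (κ : Z → W → ℝ) : ℝ :=
  -∑ ω, channelLaw P z κ ω * Real.logb 2 (κ (z ω.2) ω.1)

theorem channel_pos {P : S → ℝ} (hP : ∀ s, 0 ≤ P s) {z : S → Z} {κ : Z → W → ℝ} {ω : W × S}
    (h : 0 < channelLaw P z κ ω) : 0 < κ (z ω.2) ω.1 :=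
  pos_of_mul_pos_left h (hP _)

theorem law_channelLaw_snd {A : Type*} [Fintype A] (P : S → ℝ) (z : S → Z) {κ : Z → W → ℝ}
    (hκ1 : ∀ ζ, ∑ w, κ ζ w = 1) (f : S → A) (a : A) :
    law (channelLaw P z κ) (fun ω => f ω.2) a = law P f a := by
  classical
  rw [law_eq_sum_ite, law_eq_sum_ite, Fintype.sum_prod_type_right]
  refine Finset.sum_congr rfl fun s _ => ?_
  split_ifs
  · simp [channelLaw, ← Finset.sum_mul, hκ1]
  · simp

theorem law_channelLaw_triple (P : S → ℝ) (z : S → Z) (κ : Z → W → ℝ) (g : S → C) (ζ : Z) (w : W)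
    (c : C) :
    law (channelLaw P z κ) (fun ω => (z ω.2, (ω.1, g ω.2))) (ζ, (w, c)) =
      κ ζ w * law P (fun s => (z s, g s)) (ζ, c) := by
  classical
  rw [law_eq_sum_ite, law_eq_sum_ite, Fintype.sum_prod_type, Finset.sum_eq_single w,
    Finset.mul_sum]
  · refine Finset.sum_congr rfl fun s _ => ?_
    simp only [Prod.mk.injEq, true_and, channelLaw]
    by_cases h : z s = ζ ∧ g s = c
    · rw [if_pos h, if_pos h, h.1]
    · rw [if_neg h, if_neg h, mul_zero]
  · intro w' _ hw'
    simp [hw']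
  · simp

/-- `I(Z ; W | C) = H(W | C) - H(W | Z)` when `W` is generated from `Z` alone. -/
theorem condMutualInfo_channelLaw {P : S → ℝ} (hP : ∀ s, 0 ≤ P s) (z : S → Z) {κ : Z → W → ℝ}
    (hκ : ∀ ζ w, 0 ≤ κ ζ w) (hκ1 : ∀ ζ, ∑ w, κ ζ w = 1) (g : S → C) :
    condMutualInfo (channelLaw P z κ) (fun ω => z ω.2) (fun ω => ω.1) (fun ω => g ω.2) =
      condEntropy (channelLaw P z κ) (fun ω => ω.1) (fun ω => g ω.2) - channelEntropy P z κ := by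
  have hp := channelLaw_nonneg hP z hκ
  unfold condMutualInfo channelEntropy
  simp only [condEntropy_eq_sum, sub_neg_eq_add, neg_add_eq_sub, ← Finset.sum_sub_distrib]
  refine Finset.sum_congr rfl fun ω _ => ?_
  rw [← mul_sub, ← mul_sub]
  rcases (hp ω).lt_or_eq with h | h
  · congr 1
    have h1 : 0 < κ (z ω.2) ω.1 := channel_pos hP h
    have h2 := h.trans_le (le_law hp (fun ω => (z ω.2, g ω.2)) ω)
    have h3 := h.trans_le (le_law hp (fun ω => g ω.2) ω)
    have h4 := h.trans_le (le_law hp (fun ω => (ω.1, g ω.2)) ω)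
    -- The Markov property of the test channel; Bayes' rule then gives the identity pointwise.
    have h5 : law (channelLaw P z κ) (fun ω => (z ω.2, (ω.1, g ω.2))) (z ω.2, (ω.1, g ω.2)) =
        κ (z ω.2) ω.1 * law (channelLaw P z κ) (fun ω => (z ω.2, g ω.2)) (z ω.2, g ω.2) := by
      rw [law_channelLaw_triple, law_channelLaw_snd P z hκ1 (fun s => (z s, g s))]
    simp only [condLaw]
    rw [h5, Real.logb_div (mul_pos h1 h2).ne' h4.ne', Real.logb_mul h1.ne' h2.ne',
      Real.logb_div h2.ne' h3.ne', Real.logb_div h4.ne' h3.ne']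
    ring
  · rw [← h]
    simp

/-- Gibbs' inequality, from `log t ≤ t - 1`. It makes the common rate nonnegative, as rounding the
index set size up requires. -/
theorem channelEntropy_le_condEntropy {P : S → ℝ} (hP : ∀ s, 0 ≤ P s) (hP1 : ∑ s, P s = 1)
    (z : S → Z) {κ : Z → W → ℝ} (hκ : ∀ ζ w, 0 ≤ κ ζ w) (hκ1 : ∀ ζ, ∑ w, κ ζ w = 1)
    (g : S → C) :
    channelEntropy P z κ ≤ condEntropy (channelLaw P z κ) (fun ω => ω.1) (fun ω => g ω.2) := by
  have hp := channelLaw_nonneg hP z hκ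
  have hlog : 0 < Real.log 2 := Real.log_pos one_lt_two
  rw [condEntropy_eq_sum, channelEntropy, neg_le_neg_iff, ← sub_nonpos, ← Finset.sum_sub_distrib]
  set q : W → S → ℝ := fun w s =>
    condLaw (channelLaw P z κ) (fun ω => ω.1) (fun ω => g ω.2) w (g s) with hq
  have hq0 : ∀ w s, 0 ≤ q w s := fun w s => condLaw_nonneg hp _ _ _ _
  have hpt : ∀ ω : W × S, channelLaw P z κ ω * Real.logb 2 (q ω.1 ω.2) -
      channelLaw P z κ ω * Real.logb 2 (κ (z ω.2) ω.1) ≤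
      (P ω.2 * q ω.1 ω.2 - channelLaw P z κ ω) / Real.log 2 := by
    intro ω
    rcases (hp ω).lt_or_eq with h | h
    · have h1 : 0 < κ (z ω.2) ω.1 := channel_pos hP h
      have h2 : 0 < q ω.1 ω.2 := condLaw_pos hp (fun ω => ω.1) (fun ω => g ω.2) h
      rw [← mul_sub, ← Real.logb_div h2.ne' h1.ne', Real.logb, ← mul_div_assoc]
      refine div_le_div_of_nonneg_right ?_ hlog.le
      calc _ ≤ channelLaw P z κ ω * (q ω.1 ω.2 / κ (z ω.2) ω.1 - 1) :=
            mul_le_mul_of_nonneg_left (Real.log_le_sub_one_of_pos (div_pos h2 h1)) h.le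
        _ = _ := by
            unfold channelLaw
            field_simp
    · rw [← h]
      have := mul_nonneg (hP ω.2) (hq0 ω.1 ω.2)
      simp only [zero_mul, sub_zero]
      positivity
  refine (Finset.sum_le_sum fun ω _ => hpt ω).trans ?_
  rw [← Finset.sum_div, Finset.sum_sub_distrib, sum_channelLaw hP1 z hκ1]
  refine div_nonpos_of_nonpos_of_nonneg (sub_nonpos.2 ?_) hlog.le
  rw [Fintype.sum_prod_type_right, ← hP1]
  refine Finset.sum_le_sum fun s _ => ?_
  change ∑ w, P s * q w s ≤ P s
  rw [← Finset.mul_sum]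
  exact mul_le_of_le_one_right (hP s) (sum_condLaw_le _ _ _ _)

theorem avg_sum_binDeficit_le {F M : Type*} [Fintype F] [Fintype M] [Nonempty F] [Nonempty M]
    [DecidableEq W] {P : S → ℝ} (hP : ∀ s, 0 ≤ P s) (hP1 : ∑ s, P s = 1)
    (z : S → Z) {κ : Z → W → ℝ} (hκ : ∀ ζ w, 0 ≤ κ ζ w) (hκ1 : ∀ ζ, ∑ w, κ ζ w = 1) {θ η : ℝ}
    (hθ : 0 ≤ θ) (hη : 0 < η) :
    ∑ b : W → F × M, iidLaw (unif (F × M)) b * ∑ s, P s * binDeficit (κ (z s)) b ≤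
      prob (channelLaw P z κ) {ω | θ < κ (z ω.2) ω.1} + η + Fintype.card F * θ / η := by
  classical
  calc _ = ∑ s, P s * ∑ b : W → F × M, iidLaw (unif (F × M)) b * binDeficit (κ (z s)) b := by
        simp only [Finset.mul_sum]
        rw [Finset.sum_comm]
        exact Finset.sum_congr rfl fun s _ => Finset.sum_congr rfl fun b _ => by ring
    _ ≤ ∑ s, P s * (prob (κ (z s)) {w | θ < κ (z s) w} + (η + Fintype.card F * θ / η)) := by
        refine Finset.sum_le_sum fun s _ => mul_le_mul_of_nonneg_left ?_ (hP s)
        rw [← add_assoc]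
        exact avg_binDeficit_le (hκ _) (hκ1 _) hθ hη
    _ = _ := by
        simp only [mul_add (P _), Finset.sum_add_distrib]
        simp only [← Finset.sum_mul, hP1, one_mul, ← add_assoc]
        congr 2
        rw [prob_eq_sum_ite, Fintype.sum_prod_type_right]
        refine Finset.sum_congr rfl fun s _ => ?_
        rw [prob_eq_sum_ite, Finset.mul_sum]
        refine Finset.sum_congr rfl fun w _ => ?_
        simp only [Set.mem_ofPred_eq, channelLaw, mul_ite, mul_zero, mul_comm]

end TestChannel

/-! ### Passing to blocks -/

section Blocks

variable {Ω Ω' A C C' : Type*} [Fintype Ω] [Fintype Ω'] [Fintype A] [Fintype C] [Fintype C']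

theorem condLaw_comp_of_injective (p : Ω → ℝ) (f : Ω → A) (g : Ω → C) {h : C → C'}
    (hh : Function.Injective h) (a : A) (c : C) :
    condLaw p f (fun ω => h (g ω)) a (h c) = condLaw p f g a c := by
  unfold condLaw law
  simp only [Prod.mk.injEq, hh.eq_iff]

/-- The map `h` reconciles a pair of blocks with a block of pairs as side information; relabelling
injectively leaves conditional laws unchanged. -/
theorem prob_condLaw_block_lt {n : ℕ} (e : Ω' ≃ (Fin n → Ω)) (p : Ω → ℝ) (f : Ω → A) (g : Ω → C)
    {h : (Fin n → C) → C'} (hh : Function.Injective h) (τ : ℝ) :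
    prob (fun ω => iidLaw p (e ω)) {ω | condLaw (fun ω => iidLaw p (e ω))
      (fun ω i => f (e ω i)) (fun ω => h fun i => g (e ω i)) (fun i => f (e ω i))
      (h fun i => g (e ω i)) < τ} =
    prob (iidLaw p) {s : Fin n → Ω | ∏ i, condLaw p f g (f (s i)) (g (s i)) < τ} := by
  rw [← prob_equiv e (iidLaw p)]
  congr 1
  ext ω
  simp only [Set.mem_ofPred_eq]
  rw [condLaw_comp_of_injective (fun ω => iidLaw p (e ω)) (fun ω i => f (e ω i))
    (fun ω i => g (e ω i)) hh,
    condLaw_equiv e (iidLaw p) (fun s i => f (s i)) (fun s i => g (s i)), condLaw_iidLaw]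

theorem eventually_prob_condLaw_lt_le {p : Ω → ℝ} (hp : ∀ ω, 0 ≤ p ω) (h1 : ∑ ω, p ω = 1)
    (f : Ω → A) (g : Ω → C) {δ ε : ℝ} (hδ : 0 < δ) (hε : 0 < ε) :
    ∀ᶠ n : ℕ in Filter.atTop, prob (iidLaw p) {s : Fin n → Ω |
      ∏ i, condLaw p f g (f (s i)) (g (s i)) < (2 : ℝ) ^ (-(n * (condEntropy p f g + δ)))} ≤ ε := by
  rw [condEntropy_eq_sum]
  exact eventually_prob_prod_lt_le hp h1 (fun ω h => condLaw_pos hp f g h) hδ hε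

end Blocks

/-! ### Index set sizes and rates -/

section Sizes

theorem one_div_mul_logb_ceil_le {n : ℕ} {r δ : ℝ} (hn : 0 < n) (hr : 0 ≤ r) (hδ : 1 ≤ n * δ) :
    1 / (n : ℝ) * Real.logb 2 (⌈(2 : ℝ) ^ (n * r)⌉₊ : ℕ) ≤ r + δ := by
  have hn' : (0 : ℝ) < n := by exact_mod_cast hn
  have h1 : (1 : ℝ) ≤ 2 ^ (n * r) := Real.one_le_rpow one_le_two (by positivity)
  have h2 : (⌈(2 : ℝ) ^ (n * r)⌉₊ : ℝ) ≤ 2 ^ (1 + n * r) := by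
    have := (Nat.ceil_lt_add_one (zero_le_one.trans h1)).le
    rw [Real.rpow_add two_pos, Real.rpow_one]
    linarith
  have h3 : Real.logb 2 (⌈(2 : ℝ) ^ (n * r)⌉₊ : ℕ) ≤ 1 + n * r := by
    rw [Real.logb_le_iff_le_rpow one_lt_two]
    · exact h2
    · exact_mod_cast Nat.ceil_pos.2 (zero_lt_one.trans_le h1)
  rw [one_div, inv_mul_le_iff₀ hn']
  linarith

theorem inv_ceil_mul_inv_rpow_le {a b c : ℝ} {N : ℝ} (hN : (2 : ℝ) ^ a ≤ N) (h : b + a = c) :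
    N⁻¹ * ((2 : ℝ) ^ b)⁻¹ ≤ (2 : ℝ) ^ (-c) := by
  rw [Real.rpow_neg zero_le_two, ← mul_inv, ← h, Real.rpow_add two_pos, mul_comm]
  gcongr

end Sizes

/-! ### Achievability and closedness of the region -/

section Achievability

variable {X Y U V W : Type*} [Fintype X] [Fintype Y] [Fintype U] [Fintype V] [Fintype W]

theorem exists_eq_channelLaw_of_admissible {Q : X × Y × U × V → ℝ} {p : W × X × Y × U × V → ℝ}
    (h : Admissible Q p) : ∃ κ : X × Y → W → ℝ, (∀ ζ w, 0 ≤ κ ζ w) ∧ (∀ ζ, ∑ w, κ ζ w = 1) ∧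
      p = channelLaw Q (fun s => (s.1, s.2.1)) κ := by
  obtain ⟨-, -, κ, hκ, hp⟩ := h
  exact ⟨fun ζ => κ ζ.1 ζ.2, fun ζ w => (hκ ζ.1 ζ.2).1 w, fun ζ => (hκ ζ.1 ζ.2).2,
    funext fun ω => hp _ _ _ _ _⟩

/-- The memoryless extension of a test channel with input in `X × Y`. -/
noncomputable def blockChannel (κ : X × Y → W → ℝ) (n : ℕ) :
    (Fin n → X) × (Fin n → Y) → (Fin n → W) → ℝ :=
  fun ζ w => ∏ i, κ (ζ.1 i, ζ.2 i) (w i)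

theorem blockChannel_nonneg {κ : X × Y → W → ℝ} (hκ : ∀ ζ w, 0 ≤ κ ζ w) {n : ℕ}
    (ζ : (Fin n → X) × (Fin n → Y)) (w : Fin n → W) : 0 ≤ blockChannel κ n ζ w :=
  Finset.prod_nonneg fun _ _ => hκ _ _

theorem sum_blockChannel {κ : X × Y → W → ℝ} (hκ1 : ∀ ζ, ∑ w, κ ζ w = 1) {n : ℕ}
    (ζ : (Fin n → X) × (Fin n → Y)) : ∑ w, blockChannel κ n ζ w = 1 := by
  unfold blockChannel
  rw [sum_pi_prod (fun i w => κ (ζ.1 i, ζ.2 i) w)]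
  simp [hκ1]

/-- Pairs of blocks as blocks of pairs. -/
def zipEquiv (A B : Type*) (n : ℕ) : (Fin n → A) × (Fin n → B) ≃ (Fin n → A × B) where
  toFun t i := (t.1 i, t.2 i)
  invFun s := (fun i => (s i).1, fun i => (s i).2)

theorem channelLaw_block (Q : X × Y × U × V → ℝ) (κ : X × Y → W → ℝ) (n : ℕ) :
    channelLaw (iidLaw Q) (fun s : Fin n → X × Y × U × V => (fun i => (s i).1, fun i => (s i).2.1))
      (blockChannel κ n) =
    fun ω => iidLaw (channelLaw Q (fun s => (s.1, s.2.1)) κ) (zipEquiv _ _ n ω) := by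
  funext ω
  simp only [channelLaw, blockChannel, iidLaw, zipEquiv, Equiv.coe_fn_mk, Finset.prod_mul_distrib]

/-- Number of values of the bin index that is fixed in advance. -/
noncomputable def commonBins (H δ : ℝ) (n : ℕ) : ℕ :=
  if H ≤ 2 * δ then 1 else ⌈(2 : ℝ) ^ (n * (H - 2 * δ))⌉₊

theorem rpow_le_commonBins {H δ : ℝ} {n : ℕ} :
    (2 : ℝ) ^ (n * (H - 2 * δ)) ≤ commonBins H δ n := by
  unfold commonBins
  split_ifs with h
  · rw [Nat.cast_one]
    exact Real.rpow_le_one_of_one_le_of_nonpos one_le_two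
      (mul_nonpos_of_nonneg_of_nonpos n.cast_nonneg (by linarith))
  · exact Nat.le_ceil _

theorem commonBins_pos {H δ : ℝ} {n : ℕ} : 0 < commonBins H δ n := by
  have := (Real.rpow_pos_of_pos two_pos _).trans_le (rpow_le_commonBins (H := H) (δ := δ) (n := n))
  exact_mod_cast this

theorem eventually_two_rpow_neg_le {δ ε : ℝ} (hδ : 0 < δ) (hε : 0 < ε) :
    ∀ᶠ n : ℕ in Filter.atTop, (2 : ℝ) ^ (-(n * δ)) ≤ ε := by
  have h1 : Filter.Tendsto (fun n : ℕ => ((2 : ℝ) ^ (-δ)) ^ n) Filter.atTop (nhds 0) :=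
    tendsto_pow_atTop_nhds_zero_of_lt_one (by positivity)
      (Real.rpow_lt_one_of_one_lt_of_neg one_lt_two (by linarith))
  filter_upwards [h1.eventually (eventually_le_nhds hε)] with n hn
  rwa [← Real.rpow_natCast, ← Real.rpow_mul zero_le_two, show -δ * (n : ℝ) = -(n * δ) by ring] at hn

theorem eventually_avg_sum_binDeficit_le {Q : X × Y × U × V → ℝ} (hQ : ∀ s, 0 ≤ Q s)
    (hQ1 : ∑ s, Q s = 1) {κ : X × Y → W → ℝ} (hκ : ∀ ζ w, 0 ≤ κ ζ w)
    (hκ1 : ∀ ζ, ∑ w, κ ζ w = 1) [DecidableEq W] {δ ε : ℝ} (hδ : 0 < δ) (hε : 0 < ε) :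
    ∀ᶠ n : ℕ in Filter.atTop, ∀ M : ℕ, 0 < M →
      ∑ b : (Fin n → W) → Fin (commonBins (channelEntropy Q (fun s => (s.1, s.2.1)) κ) δ n) × Fin M,
        iidLaw (unif (_ × Fin M)) b * ∑ s : Fin n → X × Y × U × V, iidLaw Q s *
          binDeficit (blockChannel κ n (fun i => (s i).1, fun i => (s i).2.1)) b ≤ 3 * ε := by
  set H := channelEntropy Q (fun s => (s.1, s.2.1)) κ with hH
  have hp := channelLaw_nonneg hQ (fun s => (s.1, s.2.1)) hκ
  have hp1 := sum_channelLaw hQ1 (fun s => (s.1, s.2.1)) hκ1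
  -- In this case a single common bin is used, and its index is trivially uniform.
  by_cases hc : H ≤ 2 * δ
  · refine Filter.Eventually.of_forall fun n M _ => ?_
    have h1 : commonBins H δ n = 1 := if_pos hc
    rw [h1]
    refine le_trans (le_of_eq ?_) (by positivity)
    refine Finset.sum_eq_zero fun b _ => ?_
    rw [Finset.sum_eq_zero, mul_zero]
    intro s _
    rw [binDeficit_eq_zero_of_subsingleton (sum_blockChannel hκ1 _), mul_zero]
  · have hlim := eventually_prob_lt_prod_le hp hp1
      (r := fun ω => κ (ω.2.1, ω.2.2.1) ω.1) (fun ω h => channel_pos hQ h) hδ hε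
    -- With `θ = 2 ^ (-(n * (H - δ)))` and `η = ε`, the last term is at most `2 * 2 ^ (-(n * δ)) /
    -- ε`, hence the demand `ε * ε / 2`.
    filter_upwards [hlim, eventually_two_rpow_neg_le hδ (show 0 < ε * ε / 2 by positivity)]
      with n hn hn2 M hM
    have : Nonempty (Fin (commonBins H δ n)) := ⟨⟨0, commonBins_pos⟩⟩
    have : Nonempty (Fin M) := ⟨⟨0, hM⟩⟩
    have hθ : (0 : ℝ) ≤ (2 : ℝ) ^ (-(n * (H - δ))) := by positivity
    refine (avg_sum_binDeficit_le (iidLaw_nonneg hQ) (sum_iidLaw hQ1)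
      (fun s : Fin n → X × Y × U × V => ((fun i => (s i).1 : Fin n → X), fun i => (s i).2.1))
      (blockChannel_nonneg hκ) (sum_blockChannel hκ1) hθ hε).trans ?_
    have e1 : prob (channelLaw (iidLaw Q)
        (fun s : Fin n → X × Y × U × V => ((fun i => (s i).1 : Fin n → X), fun i => (s i).2.1))
        (blockChannel κ n)) {ω | (2 : ℝ) ^ (-(n * (H - δ))) <
          blockChannel κ n (fun i => (ω.2 i).1, fun i => (ω.2 i).2.1) ω.1} ≤ ε := by
      rw [channelLaw_block]
      refine le_of_eq_of_le ?_ hn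
      rw [← prob_equiv (zipEquiv _ _ n)
        (iidLaw (channelLaw Q (fun s : X × Y × U × V => (s.1, s.2.1)) κ))]
      rfl
    have e2 : (Fintype.card (Fin (commonBins H δ n)) : ℝ) * (2 : ℝ) ^ (-(n * (H - δ))) / ε ≤ ε := by
      have h1 : commonBins H δ n = ⌈(2 : ℝ) ^ (n * (H - 2 * δ))⌉₊ := if_neg hc
      have h2 : (1 : ℝ) ≤ 2 ^ (n * (H - 2 * δ)) :=
        Real.one_le_rpow one_le_two (mul_nonneg n.cast_nonneg (by linarith))
      have h3 := (Nat.ceil_lt_add_one (zero_le_one.trans h2)).le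
      rw [Fintype.card_fin, h1, div_le_iff₀ hε]
      calc _ ≤ 2 * (2 : ℝ) ^ (n * (H - 2 * δ)) * (2 : ℝ) ^ (-(n * (H - δ))) := by
            gcongr
            linarith
        _ = 2 * (2 : ℝ) ^ (-(n * δ)) := by
            rw [mul_assoc, ← Real.rpow_add two_pos]
            ring_nf
        _ ≤ _ := by linarith
    linarith

theorem achievable_of_mem_innerSet {Q : X × Y × U × V → ℝ}
    (hQ : Q ∈ stdSimplex ℝ (X × Y × U × V)) {p : W × X × Y × U × V → ℝ} (hp : Admissible Q p)
    {R : ℝ × ℝ × ℝ} (hR : R ∈ innerSet p) : Achievable Q R := by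
  classical
  obtain ⟨κ, hκ, hκ1, rfl⟩ := exists_eq_channelLaw_of_admissible hp
  obtain ⟨hQ0, hQ1⟩ := hQ
  set p := channelLaw Q (fun s => (s.1, s.2.1)) κ with hpdef
  have hp0 : ∀ ω, 0 ≤ p ω := channelLaw_nonneg hQ0 _ hκ
  have hp1 : ∑ ω, p ω = 1 := sum_channelLaw hQ1 _ hκ1
  obtain ⟨⟨w₀, x₀, y₀, -⟩⟩ : Nonempty (W × X × Y × U × V) := by
    by_contra h
    rw [not_nonempty_iff] at h
    simp at hp1
  have : Nonempty W := ⟨w₀⟩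
  have : Nonempty X := ⟨x₀⟩
  have : Nonempty Y := ⟨y₀⟩
  obtain ⟨hR0, hR1, hR2⟩ := hR
  dsimp only at hR0 hR1 hR2
  set H := channelEntropy Q (fun s => (s.1, s.2.1)) κ with hH
  set HU := condEntropy p (fun ω => ω.1) (fun ω => ω.2.2.2.1) with hHU
  set HV := condEntropy p (fun ω => ω.1) (fun ω => ω.2.2.2.2) with hHV
  set HX := condEntropy p (fun ω => ω.2.1) (fun ω => (ω.1, ω.2.2.2.1)) with hHX
  set HY := condEntropy p (fun ω => ω.2.2.1) (fun ω => (ω.1, ω.2.2.2.2)) with hHY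
  have hIU : condMutualInfo p (fun ω => (ω.2.1, ω.2.2.1)) (fun ω => ω.1) (fun ω => ω.2.2.2.1) =
      HU - H := condMutualInfo_channelLaw hQ0 _ hκ hκ1 (fun s => s.2.2.1)
  have hIV : condMutualInfo p (fun ω => (ω.2.1, ω.2.2.1)) (fun ω => ω.1) (fun ω => ω.2.2.2.2) =
      HV - H := condMutualInfo_channelLaw hQ0 _ hκ hκ1 (fun s => s.2.2.2)
  rw [hIU, hIV] at hR0
  have hHHU : H ≤ HU := channelEntropy_le_condEntropy hQ0 hQ1 _ hκ hκ1 (fun s => s.2.2.1)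
  have hHX0 : 0 ≤ HX := condEntropy_nonneg hp0 _ _
  have hHY0 : 0 ≤ HY := condEntropy_nonneg hp0 _ _
  intro ε hε
  -- The largest rate loss is `5 * δ`: `4 * δ` in the exponent of `M₀` and `δ` for rounding. The
  -- error budget is `14 * η`: four atypicality terms, four collision terms, and `2 * (3 * η)` for
  -- the deficit.
  obtain ⟨δ, hδ⟩ : ∃ δ, δ = ε / 8 := ⟨_, rfl⟩
  obtain ⟨η, hη⟩ : ∃ η, η = ε / 14 := ⟨_, rfl⟩
  have hδ0 : 0 < δ := by rw [hδ]; positivity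
  have hη0 : 0 < η := by rw [hη]; positivity
  obtain ⟨I, hI⟩ : ∃ I, I = max (HU - H) (HV - H) := ⟨_, rfl⟩
  have hI1 : HU - H ≤ I := hI ▸ le_max_left _ _
  have hI2 : HV - H ≤ I := hI ▸ le_max_right _ _
  have hsize : ∀ᶠ n : ℕ in Filter.atTop, 1 ≤ (n : ℝ) * δ := by
    filter_upwards [Filter.eventually_ge_atTop ⌈δ⁻¹⌉₊] with n hn
    have := (Nat.le_ceil δ⁻¹).trans (Nat.cast_le.2 hn)
    rwa [inv_le_iff_one_le_mul₀ hδ0] at this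
  filter_upwards [eventually_prob_condLaw_lt_le hp0 hp1 (fun ω => ω.1) (fun ω => ω.2.2.2.1) hδ0 hη0,
    eventually_prob_condLaw_lt_le hp0 hp1 (fun ω => ω.1) (fun ω => ω.2.2.2.2) hδ0 hη0,
    eventually_prob_condLaw_lt_le hp0 hp1 (fun ω => ω.2.1) (fun ω => (ω.1, ω.2.2.2.1)) hδ0 hη0,
    eventually_prob_condLaw_lt_le hp0 hp1 (fun ω => ω.2.2.1) (fun ω => (ω.1, ω.2.2.2.2)) hδ0 hη0,
    eventually_avg_sum_binDeficit_le hQ0 hQ1 hκ hκ1 hδ0 hη0, eventually_two_rpow_neg_le hδ0 hη0,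
    hsize, Filter.eventually_gt_atTop 0] with n hnU hnV hnX hnY hdef hexp hnδ hn
  rw [← hHU] at hnU
  rw [← hHV] at hnV
  rw [← hHX] at hnX
  rw [← hHY] at hnY
  have hn' : (0 : ℝ) < n := by exact_mod_cast hn
  have hceil : ∀ r : ℝ, 0 < ⌈(2 : ℝ) ^ (n * r)⌉₊ := fun r => Nat.ceil_pos.2 (by positivity)
  -- The surplus `4 * δ` offsets the `2 * δ` missing from `commonBins`: together the bins number at
  -- least `2 ^ (n * (I + H + 2 * δ))`.
  obtain ⟨M₀, hM₀⟩ : ∃ M, M = ⌈(2 : ℝ) ^ (n * (I + 4 * δ))⌉₊ := ⟨_, rfl⟩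
  obtain ⟨M₁, hM₁⟩ : ∃ M, M = ⌈(2 : ℝ) ^ (n * (HX + 2 * δ))⌉₊ := ⟨_, rfl⟩
  obtain ⟨M₂, hM₂⟩ : ∃ M, M = ⌈(2 : ℝ) ^ (n * (HY + 2 * δ))⌉₊ := ⟨_, rfl⟩
  have hM₀0 : 0 < M₀ := hM₀ ▸ hceil _
  have : Nonempty (Fin M₀) := ⟨⟨0, hM₀0⟩⟩
  have : Nonempty (Fin M₁) := ⟨⟨0, hM₁ ▸ hceil _⟩⟩
  have : Nonempty (Fin M₂) := ⟨⟨0, hM₂ ▸ hceil _⟩⟩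
  have : Nonempty (Fin (commonBins H δ n)) := ⟨⟨0, commonBins_pos⟩⟩
  obtain ⟨enc, decX, decY, hcode⟩ := exists_one_shot_code (F := Fin (commonBins H δ n))
    (M := Fin M₀) (M₁ := Fin M₁) (M₂ := Fin M₂)
    (iidLaw_nonneg hQ0) (sum_iidLaw hQ1)
    (fun (s : Fin n → X × Y × U × V) i => (s i).1) (fun s i => (s i).2.1)
    (fun s i => (s i).2.2.1) (fun s i => (s i).2.2.2)
    (blockChannel_nonneg hκ) (sum_blockChannel hκ1) (channelLaw_block Q κ n).symm
    -- Since `I + H` dominates both `HU` and `HV`, one threshold serves both receivers.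
    (τ := (2 : ℝ) ^ (-(n * (I + H + δ)))) (τ₁ := (2 : ℝ) ^ (-(n * (HX + δ))))
    (τ₂ := (2 : ℝ) ^ (-(n * (HY + δ)))) (by positivity) (by positivity) (by positivity)
    (hdef M₀ hM₀0)
  have tU := prob_condLaw_block_lt (zipEquiv W (X × Y × U × V) n) p (fun ω => ω.1)
    (fun ω => ω.2.2.2.1) Function.injective_id ((2 : ℝ) ^ (-(n * (I + H + δ))))
  have tV := prob_condLaw_block_lt (zipEquiv W (X × Y × U × V) n) p (fun ω => ω.1)
    (fun ω => ω.2.2.2.2) Function.injective_id ((2 : ℝ) ^ (-(n * (I + H + δ))))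
  have tX := prob_condLaw_block_lt (zipEquiv W (X × Y × U × V) n) p (fun ω => ω.2.1)
    (fun ω => (ω.1, ω.2.2.2.1)) (zipEquiv W U n).symm.injective ((2 : ℝ) ^ (-(n * (HX + δ))))
  have tY := prob_condLaw_block_lt (zipEquiv W (X × Y × U × V) n) p (fun ω => ω.2.2.1)
    (fun ω => (ω.1, ω.2.2.2.2)) (zipEquiv W V n).symm.injective ((2 : ℝ) ^ (-(n * (HY + δ))))
  have hmono : ∀ {a : ℝ}, a ≤ I + H → (2 : ℝ) ^ (-(n * (I + H + δ))) ≤ 2 ^ (-(n * (a + δ))) := by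
    intro a ha
    refine Real.rpow_le_rpow_of_exponent_le one_le_two (neg_le_neg ?_)
    gcongr
  have bU := tU.trans_le ((prob_mono (iidLaw_nonneg hp0) fun s _ hs =>
    lt_of_lt_of_le hs (hmono (by linarith))).trans hnU)
  have bV := tV.trans_le ((prob_mono (iidLaw_nonneg hp0) fun s _ hs =>
    lt_of_lt_of_le hs (hmono (by linarith))).trans hnV)
  have bX := tX.trans_le hnX
  have bY := tY.trans_le hnY
  have cM : ((commonBins H δ n : ℝ) * M₀)⁻¹ * ((2 : ℝ) ^ (-(n * (I + H + δ))))⁻¹ ≤ η := by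
    refine (inv_ceil_mul_inv_rpow_le (a := n * (H - 2 * δ) + n * (I + 4 * δ)) ?_ ?_).trans hexp
    · rw [Real.rpow_add two_pos]
      exact mul_le_mul rpow_le_commonBins (hM₀ ▸ Nat.le_ceil _) (by positivity) (by positivity)
    · ring
  have cM₁ : (M₁ : ℝ)⁻¹ * ((2 : ℝ) ^ (-(n * (HX + δ))))⁻¹ ≤ η :=
    (inv_ceil_mul_inv_rpow_le (a := n * (HX + 2 * δ)) (hM₁ ▸ Nat.le_ceil _) (by ring)).trans hexp
  have cM₂ : (M₂ : ℝ)⁻¹ * ((2 : ℝ) ^ (-(n * (HY + δ))))⁻¹ ≤ η :=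
    (inv_ceil_mul_inv_rpow_le (a := n * (HY + 2 * δ)) (hM₂ ▸ Nat.le_ceil _) (by ring)).trans hexp
  simp only [Fintype.card_fin] at hcode
  refine ⟨M₀, M₁, M₂, ⟨enc, decX, decY⟩, ?_, ?_, ?_, ?_⟩
  · have hX0 := prob_nonneg (iidLaw_nonneg hQ0)
      {s : Fin n → X × Y × U × V | decX ((enc (fun i => (s i).1, fun i => (s i).2.1)).1,
        (enc (fun i => (s i).1, fun i => (s i).2.1)).2.1, fun i => (s i).2.2.1) ≠ fun i => (s i).1}
    have hY0 := prob_nonneg (iidLaw_nonneg hQ0)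
      {s : Fin n → X × Y × U × V | decY ((enc (fun i => (s i).1, fun i => (s i).2.1)).1,
        (enc (fun i => (s i).1, fun i => (s i).2.1)).2.2, fun i => (s i).2.2.2) ≠
          fun i => (s i).2.1}
    have htot := hcode.trans (add_le_add (add_le_add (add_le_add (add_le_add (add_le_add bU bV)
      (mul_le_mul_of_nonneg_left cM zero_le_two)) (add_le_add bX cM₁)) (add_le_add bY cM₂))
      le_rfl)
    have h14 : η * 14 = ε := by rw [hη]; ring
    refine max_le ?_ ?_
    · refine le_trans (le_add_of_nonneg_right hY0) (htot.trans ?_)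
      linarith
    · refine le_trans (le_add_of_nonneg_left hX0) (htot.trans ?_)
      linarith
  · rw [hM₀]
    refine (one_div_mul_logb_ceil_le hn (by linarith) hnδ).trans ?_
    rw [← hI] at hR0
    linarith
  · rw [hM₁]
    refine (one_div_mul_logb_ceil_le hn (by linarith) hnδ).trans ?_
    linarith
  · rw [hM₂]
    refine (one_div_mul_logb_ceil_le hn (by linarith) hnδ).trans ?_
    linarith

/-- Achievability allows slack `ε`: half absorbs the distance to a nearby achievable triple, half is
the slack of that triple. -/
theorem isClosed_rateRegion (Q : X × Y × U × V → ℝ) : IsClosed (rateRegion Q) := by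
  refine isClosed_of_closure_subset fun R hR ε hε => ?_
  obtain ⟨R', hR', hd⟩ := Metric.mem_closure_iff.1 hR (ε / 2) (half_pos hε)
  rw [Prod.dist_eq, Prod.dist_eq, max_lt_iff, max_lt_iff] at hd
  obtain ⟨h0, h1, h2⟩ := hd
  rw [Real.dist_eq, abs_sub_lt_iff] at h0 h1 h2
  filter_upwards [hR' (ε / 2) (half_pos hε)] with n hn
  obtain ⟨M₀, M₁, M₂, c, hc, hc0, hc1, hc2⟩ := hn
  exact ⟨M₀, M₁, M₂, c, by linarith, by linarith, by linarith, by linarith⟩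

end Achievability

end GrayWyner

theorem theorem2 {X Y U V : Type*} [Fintype X] [Fintype Y] [Fintype U] [Fintype V]
    (Q : X × Y × U × V → ℝ) (hQ : Q ∈ stdSimplex ℝ (X × Y × U × V)) :
    GrayWyner.innerBound Q ⊆ GrayWyner.rateRegion Q := by
  refine closure_minimal ?_ (GrayWyner.isClosed_rateRegion Q)
  rintro R ⟨k, -, p, hp, hR⟩
  exact GrayWyner.achievable_of_mem_innerSet hQ hp hR
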